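/- Let $\mathcal H_\alpha$ be the space of $\alpha$-Hölder functions $x\colon[0,1]\to\mathbb R$ with norm $\|x\|_{\mathcal H_\alpha}=\sup_{0\le s<t\le1}|x(t)-x(s)|/(t-s)^\alpha+|x(0)|$. For a bijective, bi-measurable, measure-preserving map $T$ of a probability space $(\Omega,\mathcal F,\mu)$ and a measurable $f\colon\Omega\to\mathbb R$ put $S_n(f)=\sum_{j=0}^{n-1}f\circ T^j$ and $W(n,f,t)=S_{[nt]}(f)+(nt-[nt])\,f\circ T^{[nt]}$ for $t\in[0,1]$. **Theorem 2 (optimality).** For every real sequence $(a_n)_{n\ge1}$ converging to $0$ and every real $p>2$ there exist a probability space $(\Omega,\mathcal F,\mu)$, a bijective, bi-measurable, measure-preserving map $T\colon\Omega\to\Omega$, a sub-$\sigma$-algebra $\mathcal M\subset\mathcal F$ with $T\mathcal M\subset\mathcal M$, and an $\mathcal M$-measurable function $f\in\mathbb L^p$ (so that $(f\circ T^j)_{j\ge0}$ is a strictly stationary sequence) such that $$\sum_{n=1}^{\infty}\frac{a_n}{n^{3/2}}\,\bigl\|\mathbb E[S_n(f)\mid\mathcal M]\bigr\|_p<\infty\quad\text{(with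 absolute convergence)},$$ but the sequence $\bigl(n^{-1/2}W(n,f,\cdot)\bigr)_{n\ge1}$ is not tight in $\mathcal H_{1/2-1/p}$. Moreover, $f$ can be chosen as $f=\mathbf 1_{\{Y=0\}}-\mu\{Y=0\}$, where $Y\colon\Omega\to\{0,1,2,\dots\}$ is such that $(Y\circ T^j)_{j\ge0}$ is a (stationary) renewal-type Markov chain: for some probability distribution $(p_j)_{j\ge1}$, its transition probabilities are $p_{k,k-1}=1$ for $k\ge1$ and $p_{0,j-1}=p_j$ for $j\ge1$. -/

import Mathlib

open MeasureTheory ProbabilityTheory Filter Topology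
open scoped NNReal ENNReal unitInterval

noncomputable section

/-! ## The Hölder space on `[0,1]` -/

/-- The `α`-Hölder continuous functions `[0,1] → ℝ`, as a vector space. -/
def holderSubmodule (α : ℝ≥0) : Submodule ℝ (I → ℝ) where
  carrier := {x | MemHolder α x}
  add_mem' hx hy := MemHolder.add hx hy
  zero_mem' := memHolder_zero
  smul_mem' _ _ hx := MemHolder.smul hx

/-- The Hölder space `H_α` of `α`-Hölder continuous functions `[0,1] → ℝ`. It is a type of its own
so that it carries the topology of the Hölder norm and not the one of pointwise convergence. -/
def HolderSpace (α : ℝ≥0) : Type := holderSubmodule α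

namespace HolderSpace

variable {α : ℝ≥0}

instance : AddCommGroup (HolderSpace α) := inferInstanceAs (AddCommGroup (holderSubmodule α))

instance : Module ℝ (HolderSpace α) := inferInstanceAs (Module ℝ (holderSubmodule α))

/-- The function underlying an element of the Hölder space. -/
def toFun (x : HolderSpace α) : I → ℝ := Subtype.val (p := (· ∈ holderSubmodule α)) x

instance : CoeFun (HolderSpace α) fun _ => I → ℝ := ⟨toFun⟩

/-- The element of the Hölder space given by a Hölder continuous function. -/
def mk (x : I → ℝ) (hx : MemHolder α x) : HolderSpace α := (⟨x, hx⟩ : holderSubmodule α)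

@[simp] lemma mk_apply (x : I → ℝ) (hx : MemHolder α x) (t : I) : mk x hx t = x t := rfl

lemma memHolder (x : HolderSpace α) : MemHolder α (x : I → ℝ) :=
  Subtype.prop (p := (· ∈ holderSubmodule α)) x

@[ext] lemma ext {x y : HolderSpace α} (h : ∀ t, x t = y t) : x = y :=
  Subtype.ext (p := (· ∈ holderSubmodule α)) (funext h)

lemma coe_zero : ((0 : HolderSpace α) : I → ℝ) = 0 := rfl
lemma coe_add (x y : HolderSpace α) : ((x + y : HolderSpace α) : I → ℝ) = x + y := rfl
lemma coe_neg (x : HolderSpace α) : ((-x : HolderSpace α) : I → ℝ) = -x := rfl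
lemma coe_smul (c : ℝ) (x : HolderSpace α) : ((c • x : HolderSpace α) : I → ℝ) = c • (x : I → ℝ) :=
  rfl

/-- `‖x‖ = sup_{s < t} |x t - x s| / (t - s) ^ α + |x 0|`; the supremum is Mathlib's Hölder
seminorm, the least `C` with `|x t - x s| ≤ C |t - s| ^ α` for all `s, t`. -/
instance : NormedAddCommGroup (HolderSpace α) :=
  AddGroupNorm.toNormedAddCommGroup
    { toFun := fun x => (nnHolderNorm α (x : I → ℝ) : ℝ) + |x 0|
      map_zero' := by simp [coe_zero]
      add_le' := fun x y => by
        have h1 : (nnHolderNorm α ((x + y : HolderSpace α) : I → ℝ) : ℝ)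
            ≤ nnHolderNorm α (x : I → ℝ) + nnHolderNorm α (y : I → ℝ) := by
          exact_mod_cast x.memHolder.nnHolderNorm_add_le y.memHolder
        have h2 : |(x + y : HolderSpace α) 0| ≤ |x 0| + |y 0| := abs_add_le _ _
        linarith
      neg' := fun x => by
        have h : (-x : HolderSpace α) = (-1 : ℝ) • x := by simp
        rw [h, coe_smul, x.memHolder.nnHolderNorm_smul (-1 : ℝ)]
        simp
      eq_zero_of_map_eq_zero' := fun x hx => by
        have h1 : (0 : ℝ) ≤ nnHolderNorm α (x : I → ℝ) := NNReal.coe_nonneg _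
        have h2 : 0 ≤ |x 0| := abs_nonneg _
        have h3 : nnHolderNorm α (x : I → ℝ) = 0 := by
          have : (nnHolderNorm α (x : I → ℝ) : ℝ) = 0 := by linarith
          exact_mod_cast this
        have h4 : x 0 = 0 := abs_eq_zero.1 (by linarith)
        ext t
        rw [x.memHolder.nnHolderNorm_eq_zero.1 h3 t 0, h4]
        rfl }

lemma norm_def (x : HolderSpace α) : ‖x‖ = (nnHolderNorm α (x : I → ℝ) : ℝ) + |x 0| := rfl

instance : NormedSpace ℝ (HolderSpace α) where
  norm_smul_le c x := by
    rw [norm_def, norm_def, coe_smul, x.memHolder.nnHolderNorm_smul c]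
    simp [abs_mul, mul_add]

instance : MeasurableSpace (HolderSpace α) := borel _

instance : BorelSpace (HolderSpace α) := ⟨rfl⟩

end HolderSpace

/-! ## The polygonal partial sum process -/

variable {Ω : Type*}

/-- `W(n,f,T,t) = S_{[nt]}(T,f) + (nt - [nt]) f ∘ T^{[nt]}` at the point `ω`, where
`S_k(T,f) = ∑_{j<k} f ∘ T^j`. -/
def partialSumProcess (T : Ω → Ω) (f : Ω → ℝ) (n : ℕ) (ω : Ω) (t : I) : ℝ :=
  birkhoffSum T f ⌊n * (t : ℝ)⌋₊ ω + (n * (t : ℝ) - ⌊n * (t : ℝ)⌋₊) * f (T^[⌊n * (t : ℝ)⌋₊] ω)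

lemma polygonal_eq_sum_clamp (c : ℕ → ℝ) (N : ℕ) (s : ℝ) (hs : 0 ≤ s) (hN : ⌊s⌋₊ < N) :
    ∑ k ∈ Finset.range ⌊s⌋₊, c k + (s - ⌊s⌋₊) * c ⌊s⌋₊
      = ∑ k ∈ Finset.range N, c k * max 0 (min 1 (s - k)) := by
  obtain ⟨M, rfl⟩ : ∃ M, N = ⌊s⌋₊ + 1 + M := ⟨N - (⌊s⌋₊ + 1), by omega⟩
  have h1 : (⌊s⌋₊ : ℝ) ≤ s := Nat.floor_le hs
  have h2 : s < ⌊s⌋₊ + 1 := Nat.lt_floor_add_one s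
  rw [Finset.sum_range_add, Finset.sum_range_succ]
  have h3 : ∑ k ∈ Finset.range M, c (⌊s⌋₊ + 1 + k) *
      max 0 (min 1 (s - ((⌊s⌋₊ + 1 + k : ℕ) : ℝ))) = 0 := by
    refine Finset.sum_eq_zero fun k _ => ?_
    have : s - ((⌊s⌋₊ + 1 + k : ℕ) : ℝ) ≤ 0 := by
      push_cast
      have : (0 : ℝ) ≤ k := Nat.cast_nonneg k
      linarith
    rw [max_eq_left ((min_le_right _ _).trans this), mul_zero]
  have h4 : ∑ k ∈ Finset.range ⌊s⌋₊, c k * max 0 (min 1 (s - (k : ℝ)))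
      = ∑ k ∈ Finset.range ⌊s⌋₊, c k := by
    refine Finset.sum_congr rfl fun k hk => ?_
    have : (k : ℝ) + 1 ≤ ⌊s⌋₊ := by exact_mod_cast Finset.mem_range.1 hk
    rw [min_eq_left (by linarith), max_eq_right zero_le_one, mul_one]
  rw [h3, h4, min_eq_right (by linarith), max_eq_right (by linarith)]
  ring

/-- The paths of the partial sum process are Lipschitz, hence `α`-Hölder for all `α ≤ 1`. -/
lemma memHolder_partialSumProcess {α : ℝ≥0} (hα : α ≤ 1) (T : Ω → Ω) (f : Ω → ℝ) (n : ℕ) (ω : Ω) :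
    MemHolder α (partialSumProcess T f n ω) := by
  have key : partialSumProcess T f n ω = ∑ k ∈ Finset.range (n + 1),
      f (T^[k] ω) • fun t : I => max 0 (min 1 ((n : ℝ) * (t : ℝ) - k)) := by
    funext t
    have h0 : 0 ≤ (n : ℝ) * (t : ℝ) := mul_nonneg (Nat.cast_nonneg n) t.2.1
    have h1 : ⌊(n : ℝ) * (t : ℝ)⌋₊ < n + 1 :=
      Nat.lt_succ_of_le (Nat.floor_le_of_le (mul_le_of_le_one_right (Nat.cast_nonneg n) t.2.2))
    simp only [Finset.sum_apply, Pi.smul_apply, smul_eq_mul]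
    exact polygonal_eq_sum_clamp (fun k => f (T^[k] ω)) (n + 1) _ h0 h1
  rw [key]
  refine Submodule.sum_mem (holderSubmodule α) fun k _ => Submodule.smul_mem _ _ ?_
  have hL : LipschitzWith n (fun t : I => max 0 (min 1 ((n : ℝ) * (t : ℝ) - k))) := by
    refine LipschitzWith.const_max (LipschitzWith.const_min ?_ 1) 0
    refine LipschitzWith.of_dist_le_mul fun s t => ?_
    rw [Real.dist_eq, Subtype.dist_eq, Real.dist_eq]
    have : (n : ℝ) * (s : ℝ) - k - (n * (t : ℝ) - k) = n * ((s : ℝ) - t) := by ring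
    rw [this, abs_mul, Nat.abs_cast]
    simp
  exact (holderWith_one.2 hL).memHolder.of_le hα

/-- The process `W(n,f,T,·)`, with values in the Hölder space. -/
def holderPartialSum {α : ℝ≥0} (hα : α ≤ 1) (T : Ω → Ω) (f : Ω → ℝ) (n : ℕ) (ω : Ω) :
    HolderSpace α :=
  HolderSpace.mk (partialSumProcess T f n ω) (memHolder_partialSumProcess hα T f n ω)

/-- The exponent `1/2 - 1/p` (non-negative as soon as `p ≥ 2`). -/
def holderExponent (p : ℝ) : ℝ≥0 := (1 / 2 - 1 / p).toNNReal

lemma holderExponent_le_one {p : ℝ} (hp : 2 < p) : holderExponent p ≤ 1 := by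
  rw [holderExponent, Real.toNNReal_le_one]
  have : 0 < 1 / p := by positivity
  linarith

/-! ## Renewal-type Markov chains -/

/-- The transition probabilities of the renewal-type chain on `{0, 1, 2, …}`: from `k + 1` the chain
moves to `k`, and from `0` it jumps to a point drawn from `q`. -/
def renewalTransition (q : PMF ℕ) : ℕ → PMF ℕ
  | 0 => q
  | k + 1 => PMF.pure k

/-- `Y` is, under `μ`, a (time-homogeneous) Markov chain on `ℕ` with transition probabilities `P`:
`μ(Y_0 = y_0, …, Y_{n+1} = y_{n+1}) = μ(Y_0 = y_0, …, Y_n = y_n) P(y_n, y_{n+1})`. -/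
def IsMarkovChain [MeasurableSpace Ω] (μ : Measure Ω) (Y : ℕ → Ω → ℕ) (P : ℕ → PMF ℕ) : Prop :=
  (∀ n, Measurable (Y n)) ∧
    ∀ (n : ℕ) (y : ℕ → ℕ),
      μ {ω | ∀ i ≤ n + 1, Y i ω = y i} = μ {ω | ∀ i ≤ n, Y i ω = y i} * P (y n) (y (n + 1))

end

/-! The chain is the residual time of a stationary renewal process in which a gap of length j + 1
has probability `q j`; rare, very long gaps do all the work. Write G for the mean gap, D for the
mean stationary residual time and P for the transition operator. The process is realised two-sidedly
by `renewalShift`; the past algebra knows the current residual time k but none of the later gaps.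

Upper bound. The Poisson equation P id - id = G 1_0 - 1 (`transOp_iterate_id_add`) gives E[S_n | M]
= (P^n id (k) - k) / G, and stationarity bounds its absolute value by min(k, n) + D G
(`abs_sum_transOp_sub_le`). Up to constants, an atom of `q` of mass w at L therefore adds at most (w
L)^(1/p) ∑ |a_n| n^(-3/2) min(L, n) to the series, and since a_n tends to 0 the last sum is o(√L)
(`truncSum_le`).

Lower bound. Along a gap L the partial sums fall linearly by L / G, so n^(-1/2) W has Hölder norm at
least (L^(1 + p/2) / n)^(1/p) / G (`le_norm_holderPartialSum`). For some n of order 1 / q(L) such a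
gap is met before time n with probability at least 1/4 (`quarter_le_measure_gap`). Hence tightness
fails once L^(1 + p/2) q(L) is unbounded.

The mass w = R L^(-(1 + p/2)) is exactly borderline: (w L)^(1/p) = R^(1/p) L^(-1/2) cancels √L, and
only the factor o(1) coming from a_n remains. It absorbs any fixed R once L is large
(`exists_gap_length`), so atoms with R = i + 1 at sufficiently large L_i give a convergent series
and a sequence that is not tight. -/

noncomputable section

/-! ## Sequences of independent gaps -/

/-- The sequence `r, u 0, u 1, …`. -/
def consSeq (r : ℕ) (u : ℕ → ℕ) : ℕ → ℕ
  | 0 => r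
  | n + 1 => u n

/-- The sequence `u 1, u 2, …`. -/
def tailSeq (u : ℕ → ℕ) : ℕ → ℕ := fun n => u (n + 1)

@[simp] lemma consSeq_zero (r : ℕ) (u : ℕ → ℕ) : consSeq r u 0 = r := rfl

@[simp] lemma tailSeq_consSeq (r : ℕ) (u : ℕ → ℕ) : tailSeq (consSeq r u) = u := rfl

@[simp] lemma consSeq_tailSeq (u : ℕ → ℕ) : consSeq (u 0) (tailSeq u) = u := by
  funext n; cases n <;> rfl

lemma measurable_consSeq : Measurable fun x : ℕ × (ℕ → ℕ) => consSeq x.1 x.2 := by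
  refine measurable_pi_iff.2 fun n => ?_
  cases n with
  | zero => exact measurable_fst
  | succ n => exact (measurable_pi_apply n).comp measurable_snd

lemma measurable_tailSeq : Measurable tailSeq :=
  measurable_pi_iff.2 fun n => measurable_pi_apply (n + 1)

/-- The law of a sequence of independent variables with law `q`. -/
def iidMeasure (q : PMF ℕ) : Measure (ℕ → ℕ) := Measure.infinitePi fun _ => q.toMeasure

instance (q : PMF ℕ) : IsProbabilityMeasure (iidMeasure q) := by
  unfold iidMeasure; infer_instance

/-- Product measures are determined by finite boxes, and on a box the factor at index 0 splits off.
This identity underlies every computation at a renewal, where a gap is drawn or filed away. -/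
lemma map_consSeq_prod_iidMeasure (q : PMF ℕ) :
    (q.toMeasure.prod (iidMeasure q)).map (fun x => consSeq x.1 x.2) = iidMeasure q := by
  refine Measure.eq_infinitePi _ fun s t ht => ?_
  rw [Measure.map_apply measurable_consSeq
    (MeasurableSet.pi s.countable_toSet fun i _ => (ht i))]
  -- Padding the box with `Set.univ` lets the index set be an initial segment, which shifts well.
  let t' : ℕ → Set ℕ := fun i => if i ∈ s then t i else Set.univ
  obtain ⟨N, hN⟩ : ∃ N, s ⊆ Finset.range (N + 1) :=
    ⟨s.sup id, fun i hi => Finset.mem_range.2 (Nat.lt_succ_of_le (Finset.le_sup (f := id) hi))⟩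
  have h1 : ((fun x : ℕ × (ℕ → ℕ) => consSeq x.1 x.2) ⁻¹' (s : Set ℕ).pi t)
      = t' 0 ×ˢ ((Finset.range N : Set ℕ).pi fun i => t' (i + 1)) := by
    ext ⟨r, u⟩
    simp only [Set.mem_preimage, Set.mem_pi, Finset.mem_coe, Set.mem_prod, Finset.mem_range, t']
    constructor
    · intro h
      refine ⟨?_, fun i _ => ?_⟩
      · split_ifs with h0
        · exact h 0 h0
        · trivial
      · split_ifs with h0
        · exact h (i + 1) h0
        · trivial
    · rintro ⟨h0, h⟩ i hi
      cases i with
      | zero => simpa [hi] using h0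
      | succ i =>
        have := h i (by have := Finset.mem_range.1 (hN hi); omega)
        rwa [if_pos hi] at this
  have h2 : ∏ i ∈ s, q.toMeasure (t i) = ∏ i ∈ Finset.range (N + 1), q.toMeasure (t' i) := by
    rw [← Finset.prod_subset hN]
    · exact Finset.prod_congr rfl fun i hi => by simp [t', hi]
    · intro i _ hi
      simp [t', hi]
  rw [h1, Measure.prod_prod, iidMeasure, Measure.infinitePi_pi, h2, Finset.prod_range_succ', mul_comm]
  exact fun i _ => MeasurableSet.of_discrete

lemma lintegral_pmf (q : PMF ℕ) (F : ℕ → ℝ≥0∞) :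
    ∫⁻ j, F j ∂q.toMeasure = ∑' j, q j * F j := by
  rw [lintegral_countable']
  exact tsum_congr fun j => by
    rw [PMF.toMeasure_apply_singleton _ _ MeasurableSet.of_discrete, mul_comm]

/-- Splitting off the first gap. -/
lemma lintegral_iidMeasure (q : PMF ℕ) {F : (ℕ → ℕ) → ℝ≥0∞} (hF : Measurable F) :
    ∫⁻ u, F u ∂iidMeasure q = ∑' r, q r * ∫⁻ u, F (consSeq r u) ∂iidMeasure q := by
  conv_lhs => rw [← map_consSeq_prod_iidMeasure q]
  have hF' : Measurable fun x : ℕ × (ℕ → ℕ) => F (consSeq x.1 x.2) := hF.comp measurable_consSeq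
  rw [lintegral_map hF measurable_consSeq, lintegral_prod _ hF'.aemeasurable, lintegral_pmf]

/-! ## The invertible renewal system -/

/-- The state space: `((u, r, k), v)` consists of the past gaps `u`, the time `r` elapsed since the
last renewal, the time `k` until the next renewal and the future gaps `v`. -/
abbrev RenewalSpace : Type := ((ℕ → ℕ) × ℕ × ℕ) × (ℕ → ℕ)

/-- The time until the next renewal. -/
def residualTime (ω : RenewalSpace) : ℕ := ω.1.2.2

/-- One step forward in time. -/
def stepFun (ω : RenewalSpace) : RenewalSpace :=
  if ω.1.2.2 = 0 then ((consSeq ω.1.2.1 ω.1.1, 0, ω.2 0), tailSeq ω.2)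
  else ((ω.1.1, ω.1.2.1 + 1, ω.1.2.2 - 1), ω.2)

/-- One step back in time, of the past alone. -/
def pastInv (x : (ℕ → ℕ) × ℕ × ℕ) : (ℕ → ℕ) × ℕ × ℕ :=
  if x.2.1 = 0 then (tailSeq x.1, x.1 0, 0) else (x.1, x.2.1 - 1, x.2.2 + 1)

/-- One step back in time. -/
def stepInv (ω : RenewalSpace) : RenewalSpace :=
  (pastInv ω.1, if ω.1.2.1 = 0 then consSeq ω.1.2.2 ω.2 else ω.2)

@[simp] lemma stepFun_zero (u v : ℕ → ℕ) (r : ℕ) :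
    stepFun ((u, r, 0), v) = ((consSeq r u, 0, v 0), tailSeq v) := rfl

@[simp] lemma stepFun_succ (u v : ℕ → ℕ) (r k : ℕ) :
    stepFun ((u, r, k + 1), v) = ((u, r + 1, k), v) := rfl

lemma measurable_residualTime : Measurable residualTime := by unfold residualTime; fun_prop

lemma measurable_pastInv : Measurable pastInv := by
  refine Measurable.ite (measurableSet_eq_fun (by fun_prop) (by fun_prop)) ?_ ?_
  · exact (measurable_tailSeq.comp measurable_fst).prodMk
      (((measurable_pi_apply 0).comp measurable_fst).prodMk measurable_const)
  · exact measurable_fst.prodMk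
      (((Measurable.of_discrete (f := fun n : ℕ => n - 1)).comp measurable_snd.fst).prodMk
        ((Measurable.of_discrete (f := fun n : ℕ => n + 1)).comp measurable_snd.snd))

lemma measurable_stepFun : Measurable stepFun := by
  refine Measurable.ite (measurableSet_eq_fun (by fun_prop) (by fun_prop)) ?_ ?_
  · refine Measurable.prodMk (Measurable.prodMk ?_ (measurable_const.prodMk ?_)) ?_
    · exact measurable_consSeq.comp (measurable_fst.snd.fst.prodMk measurable_fst.fst)
    · exact (measurable_pi_apply 0).comp measurable_snd
    · exact measurable_tailSeq.comp measurable_snd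
  · exact (measurable_fst.fst.prodMk
      (((Measurable.of_discrete (f := fun n : ℕ => n + 1)).comp measurable_fst.snd.fst).prodMk
        ((Measurable.of_discrete (f := fun n : ℕ => n - 1)).comp measurable_fst.snd.snd))).prodMk
      measurable_snd

lemma measurable_stepInv : Measurable stepInv := by
  refine (measurable_pastInv.comp measurable_fst).prodMk ?_
  refine Measurable.ite (measurableSet_eq_fun (by fun_prop) (by fun_prop)) ?_ measurable_snd
  exact measurable_consSeq.comp (measurable_fst.snd.snd.prodMk measurable_snd)

/-- The time shift of the renewal system. -/
def renewalShift : RenewalSpace ≃ᵐ RenewalSpace where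
  toFun := stepFun
  invFun := stepInv
  left_inv := by
    rintro ⟨⟨u, r, _ | k⟩, v⟩ <;> simp [stepInv, pastInv]
  right_inv := by
    rintro ⟨⟨u, _ | r, k⟩, v⟩ <;> simp [stepInv, pastInv]
  measurable_toFun := measurable_stepFun
  measurable_invFun := measurable_stepInv

@[simp] lemma coe_renewalShift : ⇑renewalShift = stepFun := rfl

/-- The mean length of the time between two renewals. -/
def meanGap (q : PMF ℕ) : ℝ≥0∞ := ∑' j, q j * ((j : ℝ≥0∞) + 1)

/-- The stationary law of the pair (elapsed time, residualTime time). -/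
def ageMeasure (q : PMF ℕ) : Measure (ℕ × ℕ) :=
  Measure.count.withDensity fun x => (meanGap q)⁻¹ * q (x.1 + x.2)

instance (q : PMF ℕ) : SFinite (ageMeasure q) := by unfold ageMeasure; infer_instance

/-- The stationary law of the renewal system. -/
def renewalMeasure (q : PMF ℕ) : Measure RenewalSpace :=
  ((iidMeasure q).prod (ageMeasure q)).prod (iidMeasure q)

lemma lintegral_ageMeasure (q : PMF ℕ) (F : ℕ × ℕ → ℝ≥0∞) :
    ∫⁻ x, F x ∂ageMeasure q = ∑' r, ∑' k, (meanGap q)⁻¹ * q (r + k) * F (r, k) := by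
  rw [ageMeasure, lintegral_withDensity_eq_lintegral_mul _ Measurable.of_discrete
    Measurable.of_discrete, lintegral_count, ENNReal.tsum_prod']
  rfl

lemma lintegral_renewalMeasure (q : PMF ℕ) {F : RenewalSpace → ℝ≥0∞} (hF : Measurable F) :
    ∫⁻ ω, F ω ∂renewalMeasure q = ∑' r, ∑' k, (meanGap q)⁻¹ * q (r + k) *
      ∫⁻ u, ∫⁻ v, F ((u, r, k), v) ∂iidMeasure q ∂iidMeasure q := by
  rw [renewalMeasure, lintegral_prod _ hF.aemeasurable,
    lintegral_prod_symm _ hF.lintegral_prod_right'.aemeasurable, lintegral_ageMeasure]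

/-- Summation along the diagonals r + k = j: within a gap j the residual time takes each of the
values 0, …, j once. -/
lemma tsum_tsum_add (q G : ℕ → ℝ≥0∞) :
    ∑' r, ∑' k, q (r + k) * G k = ∑' j, q j * ∑ k ∈ Finset.range (j + 1), G k := by
  rw [← ENNReal.tsum_prod (f := fun r k => q (r + k) * G k),
    ← Finset.HasAntidiagonal.sigmaAntidiagonalEquivProd.tsum_eq, ENNReal.tsum_sigma']
  refine tsum_congr fun j => ?_
  rw [tsum_fintype, Finset.mul_sum]
  simp only [Finset.HasAntidiagonal.sigmaAntidiagonalEquivProd_apply]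
  rw [Finset.sum_coe_sort (Finset.HasAntidiagonal.antidiagonal j) (fun x => q (x.1 + x.2) * G x.2),
    ← Finset.Nat.sum_antidiagonal_swap]
  simp only [Prod.fst_swap, Prod.snd_swap]
  rw [Finset.Nat.sum_antidiagonal_eq_sum_range_succ (fun a b => q (b + a) * G a)]
  exact Finset.sum_congr rfl fun k hk => by
    rw [Nat.sub_add_cancel (Nat.lt_succ_iff.1 (Finset.mem_range.1 hk))]

lemma one_le_meanGap (q : PMF ℕ) : 1 ≤ meanGap q := by
  rw [← q.tsum_coe]
  exact ENNReal.tsum_le_tsum fun j => le_mul_of_one_le_right' (by simp)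

lemma meanGap_ne_zero (q : PMF ℕ) : meanGap q ≠ 0 :=
  (zero_lt_one.trans_le (one_le_meanGap q)).ne'

/-- Integrals of functions of the residual time. -/
lemma lintegral_residualTime (q : PMF ℕ) (G : ℕ → ℝ≥0∞) :
    ∫⁻ ω, G (residualTime ω) ∂renewalMeasure q
      = (meanGap q)⁻¹ * ∑' j, q j * ∑ k ∈ Finset.range (j + 1), G k := by
  have hG : Measurable fun ω => G (residualTime ω) :=
    Measurable.of_discrete.comp measurable_residualTime
  rw [lintegral_renewalMeasure q hG, ← tsum_tsum_add, ← ENNReal.tsum_mul_left]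
  refine tsum_congr fun r => ?_
  rw [← ENNReal.tsum_mul_left]
  refine tsum_congr fun k => ?_
  simp [residualTime, mul_assoc]

lemma isProbabilityMeasure_ageMeasure (q : PMF ℕ) (hq : meanGap q ≠ ∞) :
    IsProbabilityMeasure (ageMeasure q) := by
  constructor
  have h : ∑' r, ∑' k, q (r + k) * 1 = meanGap q := by
    rw [tsum_tsum_add q fun _ => 1]
    simp [meanGap]
  rw [← lintegral_one, lintegral_ageMeasure]
  simp only [mul_assoc, ENNReal.tsum_mul_left]
  rw [h, ENNReal.inv_mul_cancel (meanGap_ne_zero q) hq]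

lemma isProbabilityMeasure_renewalMeasure (q : PMF ℕ) (hq : meanGap q ≠ ∞) :
    IsProbabilityMeasure (renewalMeasure q) := by
  have := isProbabilityMeasure_ageMeasure q hq
  unfold renewalMeasure
  infer_instance

/-- Inside a gap, (r, k + 1) moves to (r + 1, k) and the weight depends only on r + k + 1. At a
renewal, the completed gap r has weight `q r` and joins the past, which stays i.i.d.; the first
future gap becomes the new k with weight `q k`, which is the slice r = 0 of the stationary law. -/
lemma measurePreserving_renewalShift (q : PMF ℕ) :
    MeasurePreserving renewalShift (renewalMeasure q) (renewalMeasure q) := by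
  refine ⟨measurable_stepFun, Measure.ext_of_lintegral _ fun F hF => ?_⟩
  have hF' : Measurable fun ω => F (stepFun ω) := hF.comp measurable_stepFun
  rw [coe_renewalShift, lintegral_map hF measurable_stepFun, lintegral_renewalMeasure q hF',
    lintegral_renewalMeasure q hF]
  set c := (meanGap q)⁻¹
  have hs : ∀ r k, ∫⁻ u, ∫⁻ v, F (stepFun ((u, r, k + 1), v)) ∂iidMeasure q ∂iidMeasure q
      = ∫⁻ u, ∫⁻ v, F ((u, r + 1, k), v) ∂iidMeasure q ∂iidMeasure q := fun r k => rfl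
  have e1 : ∀ r, ∑' k, c * q (r + k) *
      ∫⁻ u, ∫⁻ v, F (stepFun ((u, r, k), v)) ∂iidMeasure q ∂iidMeasure q
      = c * q r * ∫⁻ u, ∫⁻ v, F ((consSeq r u, 0, v 0), tailSeq v) ∂iidMeasure q ∂iidMeasure q
      + ∑' k, c * q (r + 1 + k) *
        ∫⁻ u, ∫⁻ v, F ((u, r + 1, k), v) ∂iidMeasure q ∂iidMeasure q := by
    intro r
    rw [tsum_eq_zero_add' ENNReal.summable]
    simp only [hs, stepFun_zero, add_zero, Nat.add_right_comm r 1, add_assoc]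
  simp only [e1]
  rw [ENNReal.tsum_add]
  conv_rhs => rw [tsum_eq_zero_add' ENNReal.summable]
  congr 1
  have hG : Measurable fun u => ∫⁻ v, F ((u, 0, v 0), tailSeq v) ∂iidMeasure q := by
    refine Measurable.lintegral_prod_right' (f := fun x : (ℕ → ℕ) × (ℕ → ℕ) =>
      F ((x.1, 0, x.2 0), tailSeq x.2)) (hF.comp ?_)
    exact (measurable_fst.prodMk (measurable_const.prodMk
      ((measurable_pi_apply 0).comp measurable_snd))).prodMk (measurable_tailSeq.comp measurable_snd)
  calc ∑' r, c * q r * ∫⁻ u, ∫⁻ v, F ((consSeq r u, 0, v 0), tailSeq v) ∂iidMeasure q ∂iidMeasure q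
      = c * ∫⁻ u, ∫⁻ v, F ((u, 0, v 0), tailSeq v) ∂iidMeasure q ∂iidMeasure q := by
        rw [lintegral_iidMeasure q hG, ← ENNReal.tsum_mul_left]
        simp only [mul_assoc]
    _ = c * ∫⁻ u, ∑' k, q k * ∫⁻ v, F ((u, 0, k), v) ∂iidMeasure q ∂iidMeasure q := by
        congr 1
        refine lintegral_congr fun u => ?_
        rw [lintegral_iidMeasure q]
        · simp
        · exact hF.comp ((measurable_const.prodMk (measurable_const.prodMk
            (measurable_pi_apply 0))).prodMk measurable_tailSeq)
    _ = _ := by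
        have hm : ∀ k, Measurable fun u => ∫⁻ v, F ((u, 0, k), v) ∂iidMeasure q := fun k => by
          refine Measurable.lintegral_prod_right' (f := fun x : (ℕ → ℕ) × (ℕ → ℕ) =>
            F ((x.1, 0, k), x.2)) (hF.comp ?_)
          fun_prop
        rw [lintegral_tsum fun k => ((hm k).const_mul _).aemeasurable, ← ENNReal.tsum_mul_left]
        refine tsum_congr fun k => ?_
        rw [lintegral_const_mul _ (hm k), zero_add, mul_assoc]

/-! ## The transition operator -/

/-- The transition operator of the renewal-type chain. -/
def transOp (q : PMF ℕ) (φ : ℕ → ℝ≥0∞) : ℕ → ℝ≥0∞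
  | 0 => ∑' j, q j * φ j
  | k + 1 => φ k

/-- The indicator function of `0`. -/
def zeroInd : ℕ → ℝ≥0∞
  | 0 => 1
  | _ + 1 => 0

lemma transOp_iterate_succ_zero (q : PMF ℕ) (φ : ℕ → ℝ≥0∞) (m : ℕ) :
    (transOp q)^[m + 1] φ 0 = ∑' j, q j * (transOp q)^[m] φ j := by
  rw [Function.iterate_succ_apply']; rfl

lemma transOp_iterate_succ_succ (q : PMF ℕ) (φ : ℕ → ℝ≥0∞) (m k : ℕ) :
    (transOp q)^[m + 1] φ (k + 1) = (transOp q)^[m] φ k := by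
  rw [Function.iterate_succ_apply']; rfl

/-- Summed form of the Poisson equation `P id - id = meanGap • 1_0 - 1`. -/
lemma transOp_iterate_id_add (q : PMF ℕ) (m k : ℕ) :
    (transOp q)^[m] (fun j => (j : ℝ≥0∞)) k + m
      = k + meanGap q * ∑ i ∈ Finset.range m, (transOp q)^[i] zeroInd k := by
  induction m generalizing k with
  | zero => simp
  | succ m ih =>
    cases k with
    | zero =>
      have h1 : ∀ j : ℕ, q j * (transOp q)^[m] (fun j => (j : ℝ≥0∞)) j + q j * m
          = q j * j + meanGap q * ∑ i ∈ Finset.range m, q j * (transOp q)^[i] zeroInd j := by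
        intro j
        rw [← mul_add, ih j, mul_add, ← Finset.mul_sum]
        ring
      have h2 : ∑' j, q j * (transOp q)^[m] (fun j => (j : ℝ≥0∞)) j + m
          = ∑' j, q j * (j : ℝ≥0∞)
            + meanGap q * ∑ i ∈ Finset.range m, ∑' j, q j * (transOp q)^[i] zeroInd j := by
        have : (m : ℝ≥0∞) = ∑' j, q j * (m : ℝ≥0∞) := by
          rw [ENNReal.tsum_mul_right, q.tsum_coe, one_mul]
        conv_lhs => rw [this]
        rw [← ENNReal.tsum_add, tsum_congr h1, ENNReal.tsum_add, ENNReal.tsum_mul_left,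
          Summable.tsum_finsetSum fun _ _ => ENNReal.summable]
      -- The Poisson equation at 0; the extra 1 is the step that leaves 0.
      have h3 : meanGap q = ∑' j, q j * (j : ℝ≥0∞) + 1 := by
        simp only [meanGap, mul_add, mul_one]
        rw [ENNReal.tsum_add, q.tsum_coe]
      have h4 : (transOp q)^[0] zeroInd 0 = 1 := rfl
      rw [Finset.sum_range_succ', h4]
      simp only [transOp_iterate_succ_zero]
      push_cast
      rw [← add_assoc, h2, zero_add, mul_add, mul_one]
      nth_rw 3 [h3]
      ring
    | succ k =>
      have h4 : (transOp q)^[0] zeroInd (k + 1) = 0 := rfl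
      rw [Finset.sum_range_succ', h4]
      simp only [transOp_iterate_succ_succ]
      push_cast
      rw [← add_assoc, ih k]
      ring

lemma transOp_iterate_add (q : PMF ℕ) (φ : ℕ → ℝ≥0∞) (m n k : ℕ) :
    (transOp q)^[m + n] φ (k + n) = (transOp q)^[m] φ k := by
  induction n with
  | zero => rfl
  | succ n ih => rw [← add_assoc, ← add_assoc, transOp_iterate_succ_succ, ih]

/-- The transition operator computes conditional expectations given the past. -/
lemma lintegral_residualTime_iterate (q : PMF ℕ) (φ : ℕ → ℝ≥0∞) (m : ℕ) (x : (ℕ → ℕ) × ℕ × ℕ) :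
    ∫⁻ v, φ (residualTime (stepFun^[m] (x, v))) ∂iidMeasure q = (transOp q)^[m] φ x.2.2 := by
  induction m generalizing x with
  | zero => simp [residualTime]
  | succ m ih =>
    obtain ⟨u, r, _ | k⟩ := x
    · simp only [Function.iterate_succ_apply, stepFun_zero]
      have hm : Measurable fun v : ℕ → ℕ =>
          φ (residualTime (stepFun^[m] ((consSeq r u, 0, v 0), tailSeq v))) := by
        refine Measurable.of_discrete.comp (measurable_residualTime.comp
          ((measurable_stepFun.iterate m).comp ?_))
        exact (measurable_const.prodMk (measurable_const.prodMk
            (measurable_pi_apply 0))).prodMk measurable_tailSeq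
      rw [lintegral_iidMeasure q hm]
      simp only [consSeq_zero, tailSeq_consSeq, ih]
      exact (transOp_iterate_succ_zero q φ m).symm
    · simp only [Function.iterate_succ_apply, stepFun_succ, ih]
      exact (transOp_iterate_succ_succ q φ m k).symm

/-- The mean of the stationary residual time. -/
def meanResidual (q : PMF ℕ) : ℝ≥0∞ := ∫⁻ ω, residualTime ω ∂renewalMeasure q

/-- By stationarity P^m id has the same mean D as id, and the state 0 alone carries stationary mass
1 / G. -/
lemma transOp_iterate_id_zero_le (q : PMF ℕ) (hq : meanGap q ≠ ∞) (m : ℕ) :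
    (transOp q)^[m] (fun j => (j : ℝ≥0∞)) 0 ≤ meanResidual q * meanGap q := by
  set φ : ℕ → ℝ≥0∞ := fun j => (j : ℝ≥0∞)
  have hφ : Measurable fun ω : RenewalSpace => φ (residualTime ω) :=
    Measurable.of_discrete.comp measurable_residualTime
  have h1 : ∫⁻ ω, φ (residualTime (stepFun^[m] ω)) ∂renewalMeasure q = meanResidual q :=
    ((measurePreserving_renewalShift q).iterate m).lintegral_comp hφ
  have hφ' : Measurable fun ω : RenewalSpace => φ (residualTime (stepFun^[m] ω)) :=
    hφ.comp (measurable_stepFun.iterate m)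
  rw [lintegral_renewalMeasure q hφ'] at h1
  simp only [lintegral_residualTime_iterate] at h1
  have h2 : (meanGap q)⁻¹ * (transOp q)^[m] φ 0 ≤ meanResidual q := by
    rw [← h1]
    calc (meanGap q)⁻¹ * (transOp q)^[m] φ 0
        = ∑' r, (meanGap q)⁻¹ * q (r + 0) * ∫⁻ _, (transOp q)^[m] φ 0 ∂iidMeasure q := by
          simp only [add_zero, lintegral_const, measure_univ, mul_one]
          rw [ENNReal.tsum_mul_right, ENNReal.tsum_mul_left, q.tsum_coe, mul_one]
      _ ≤ _ := ENNReal.tsum_le_tsum fun r => ENNReal.le_tsum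
          (f := fun k => (meanGap q)⁻¹ * q (r + k) * ∫⁻ _, (transOp q)^[m] φ k ∂iidMeasure q) 0
  rwa [mul_comm, ← div_eq_mul_inv, ENNReal.div_le_iff (meanGap_ne_zero q) hq] at h2

lemma transOp_iterate_id_of_le (q : PMF ℕ) {n k : ℕ} (h : n ≤ k) :
    (transOp q)^[n] (fun j => (j : ℝ≥0∞)) k = (k - n : ℕ) := by
  obtain ⟨l, rfl⟩ := Nat.exists_eq_add_of_le' h
  have := transOp_iterate_add q (fun j => (j : ℝ≥0∞)) 0 n l
  rw [zero_add] at this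
  simp [this]

lemma transOp_iterate_id_le_of_le (q : PMF ℕ) (hq : meanGap q ≠ ∞) {n k : ℕ} (h : k ≤ n) :
    (transOp q)^[n] (fun j => (j : ℝ≥0∞)) k ≤ meanResidual q * meanGap q := by
  obtain ⟨l, rfl⟩ := Nat.exists_eq_add_of_le' h
  have := transOp_iterate_add q (fun j => (j : ℝ≥0∞)) l k 0
  rw [zero_add] at this
  rw [this]
  exact transOp_iterate_id_zero_le q hq l

/-- The expected number of renewals before time `n`, centred, is at most `min k n + C` in absolute
value when the chain starts at `k`. -/
lemma abs_sum_transOp_sub_le (q : PMF ℕ) (hq : meanGap q ≠ ∞) (hD : meanResidual q ≠ ∞) (n k : ℕ) :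
    |∑ i ∈ Finset.range n, ((transOp q)^[i] zeroInd k).toReal - n * (meanGap q)⁻¹.toReal|
      ≤ (min k n : ℕ) + (meanResidual q * meanGap q).toReal := by
  set C := meanResidual q * meanGap q
  have hC : C ≠ ∞ := ENNReal.mul_ne_top hD hq
  set G := (meanGap q).toReal
  have hG : 1 ≤ G := by
    rw [← ENNReal.toReal_one]
    exact ENNReal.toReal_mono hq (one_le_meanGap q)
  have hH : (transOp q)^[n] (fun j => (j : ℝ≥0∞)) k ≠ ∞ := by
    rcases le_total n k with h | h
    · rw [transOp_iterate_id_of_le q h]; exact ENNReal.natCast_ne_top _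
    · exact ne_top_of_le_ne_top hC (transOp_iterate_id_le_of_le q hq h)
  have hS : ∑ i ∈ Finset.range n, (transOp q)^[i] zeroInd k ≠ ∞ := by
    intro h
    have := transOp_iterate_id_add q n k
    rw [h, ENNReal.mul_top (meanGap_ne_zero q), add_top] at this
    exact ENNReal.add_ne_top.2 ⟨hH, ENNReal.natCast_ne_top n⟩ this
  have key := congrArg ENNReal.toReal (transOp_iterate_id_add q n k)
  rw [ENNReal.toReal_add hH (ENNReal.natCast_ne_top n),
    ENNReal.toReal_add (ENNReal.natCast_ne_top k) (ENNReal.mul_ne_top hq hS), ENNReal.toReal_mul,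
    ENNReal.toReal_natCast, ENNReal.toReal_natCast,
    ENNReal.toReal_sum fun i hi => ENNReal.sum_ne_top.1 hS i hi] at key
  set H := ((transOp q)^[n] (fun j => (j : ℝ≥0∞)) k).toReal with hHdef
  set S := ∑ i ∈ Finset.range n, ((transOp q)^[i] zeroInd k).toReal
  rw [ENNReal.toReal_inv]
  change |S - n * G⁻¹| ≤ _
  have hSG : S - n * G⁻¹ = (H - k) / G := by
    have : G ≠ 0 := by positivity
    field_simp
    linarith
  -- For n ≤ k the chain merely descends, so H - k = -n; for k ≤ n it has reached 0 and H is at most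
  -- C.
  have hHk : |H - k| ≤ (min k n : ℕ) + C.toReal := by
    have hC0 : 0 ≤ C.toReal := ENNReal.toReal_nonneg
    rcases le_total n k with h | h
    · rw [hHdef, transOp_iterate_id_of_le q h, min_eq_right h, ENNReal.toReal_natCast,
        Nat.cast_sub h]
      rw [sub_sub_cancel_left, abs_neg, Nat.abs_cast]
      linarith
    · have h1 : H ≤ C.toReal := ENNReal.toReal_mono hC (transOp_iterate_id_le_of_le q hq h)
      have h2 : 0 ≤ H := ENNReal.toReal_nonneg
      rw [min_eq_left h, abs_le]
      have h3 : (0 : ℝ) ≤ k := Nat.cast_nonneg k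
      constructor <;> linarith
  rw [hSG, abs_div, abs_of_pos (by positivity : 0 < G)]
  exact (div_le_self (abs_nonneg _) hG).trans hHk

/-! ## Conditional expectations given the past -/

/-- Conditional expectation given the first coordinate of a product. -/
lemma condExp_comap_fst_prod {α β : Type*} [mα : MeasurableSpace α] [MeasurableSpace β]
    (ρ : Measure α) (ν : Measure β) [IsProbabilityMeasure ρ] [IsProbabilityMeasure ν]
    {F : α × β → ℝ} (hF : Integrable F (ρ.prod ν)) :
    (ρ.prod ν)[F | mα.comap Prod.fst] =ᵐ[ρ.prod ν] fun x => ∫ v, F (x.1, v) ∂ν := by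
  have hle : mα.comap (Prod.fst : α × β → α) ≤ (inferInstance : MeasurableSpace (α × β)) := fun _ ⟨_, hB, h⟩ => h ▸ measurable_fst hB
  have hG : Integrable (fun x => ∫ v, F (x, v) ∂ν) ρ := hF.integral_prod_left
  have hG' : Integrable (fun x : α × β => ∫ v, F (x.1, v) ∂ν) (ρ.prod ν) :=
    hG.comp_fst ν
  refine (ae_eq_condExp_of_forall_setIntegral_eq hle hF (fun s _ _ => hG'.integrableOn)
    ?_ ?_).symm
  · rintro s ⟨B, hB, rfl⟩ -
    have : (Prod.fst ⁻¹' B : Set (α × β)) = B ×ˢ Set.univ := by ext; simp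
    rw [this, setIntegral_prod _ hG'.integrableOn, setIntegral_prod _ hF.integrableOn]
    simp
  · have h := hG.aestronglyMeasurable
    rw [← measurePreserving_fst (μ := ρ) (ν := ν) |>.map_eq] at h
    exact h.comp_ae_measurable' measurable_fst.aemeasurable

/-- The sub-σ-algebra of the past. -/
abbrev pastAlgebra : MeasurableSpace RenewalSpace := MeasurableSpace.comap Prod.fst inferInstance

/-- The past component of `stepInv` is a function `pastInv` of the past alone, so images of past
events are preimages under it. -/
lemma measurableSet_pastAlgebra_image {A : Set RenewalSpace} (hA : MeasurableSet[pastAlgebra] A) :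
    MeasurableSet[pastAlgebra] (renewalShift '' A) := by
  obtain ⟨B, hB, rfl⟩ := hA
  refine ⟨pastInv ⁻¹' B, measurable_pastInv hB, ?_⟩
  have : ⇑renewalShift = ⇑renewalShift.toEquiv := rfl
  rw [this, Equiv.image_eq_preimage_symm]
  rfl

/-! ## The Markov property -/

/-- First-step analysis with the past x frozen. Since x enters only through the initial indicator,
integrating over x leaves a factor independent of n, and the Markov property follows. -/
lemma iidMeasure_path (q : PMF ℕ) (n : ℕ) (y : ℕ → ℕ) (x : (ℕ → ℕ) × ℕ × ℕ) :
    iidMeasure q {v | ∀ i ≤ n, residualTime (stepFun^[i] (x, v)) = y i}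
      = (if x.2.2 = y 0 then 1 else 0)
        * ∏ i ∈ Finset.range n, renewalTransition q (y i) (y (i + 1)) := by
  induction n generalizing x y with
  | zero =>
    by_cases h : x.2.2 = y 0 <;> simp [residualTime, h]
  | succ n ih =>
    have hsplit : {v | ∀ i ≤ n + 1, residualTime (stepFun^[i] (x, v)) = y i}
        = {v | x.2.2 = y 0 ∧
            ∀ i ≤ n, residualTime (stepFun^[i] (stepFun (x, v))) = y (i + 1)} := by
      ext v
      refine ⟨fun h => ⟨h 0 (Nat.zero_le _), fun i hi => h (i + 1) (by omega)⟩, fun h i hi => ?_⟩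
      cases i with
      | zero => exact h.1
      | succ i => exact h.2 i (by omega)
    rw [hsplit]
    by_cases h0 : x.2.2 = y 0
    swap
    · simp [h0]
    simp only [h0, true_and, if_true, one_mul]
    rw [Finset.prod_range_succ', mul_comm]
    obtain ⟨u, r, _ | k⟩ := x
    · simp only at h0
      simp only [stepFun_zero]
      rw [zero_add, ← h0]
      have hm : MeasurableSet {v : ℕ → ℕ | ∀ i ≤ n,
          residualTime (stepFun^[i] ((consSeq r u, 0, v 0), tailSeq v)) = y (i + 1)} := by
        simp only [Set.ofPred_forall]
        refine MeasurableSet.iInter fun i => MeasurableSet.iInter fun _ =>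
          measurableSet_eq_fun (measurable_residualTime.comp
            ((measurable_stepFun.iterate i).comp ?_)) measurable_const
        exact (measurable_const.prodMk (measurable_const.prodMk
            (measurable_pi_apply 0))).prodMk measurable_tailSeq
      rw [← lintegral_indicator_one hm, lintegral_iidMeasure q (measurable_one.indicator hm)]
      have hj : ∀ j, ∫⁻ v, ({v : ℕ → ℕ | ∀ i ≤ n,
          residualTime (stepFun^[i] ((consSeq r u, 0, v 0), tailSeq v)) = y (i + 1)}).indicator
            (1 : (ℕ → ℕ) → ℝ≥0∞) (consSeq j v) ∂iidMeasure q
          = (if j = y 1 then 1 else 0)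
            * ∏ i ∈ Finset.range n, renewalTransition q (y (i + 1)) (y (i + 1 + 1)) := by
        intro j
        rw [← ih (fun i => y (i + 1)) (consSeq r u, 0, j), ← lintegral_indicator_one]
        · rfl
        · simp only [Set.ofPred_forall]
          refine MeasurableSet.iInter fun i => MeasurableSet.iInter fun _ =>
            measurableSet_eq_fun (measurable_residualTime.comp
              ((measurable_stepFun.iterate i).comp (by fun_prop))) measurable_const
      simp only [hj]
      rw [tsum_eq_single (y 1) fun j hj => by simp [hj]]
      simp [renewalTransition]
    · simp only at h0
      simp only [stepFun_succ]
      rw [ih (fun i => y (i + 1)), ← h0]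
      simp only [renewalTransition, PMF.pure_apply, zero_add, eq_comm]

lemma isMarkovChain_residualTime (q : PMF ℕ) :
    IsMarkovChain (renewalMeasure q) (fun j ω => residualTime (renewalShift^[j] ω))
      (renewalTransition q) := by
  refine ⟨fun n => measurable_residualTime.comp (measurable_stepFun.iterate n), fun n y => ?_⟩
  have hm : ∀ n, MeasurableSet {ω | ∀ i ≤ n, residualTime (stepFun^[i] ω) = y i} := fun n => by
    simp only [Set.ofPred_forall]
    exact MeasurableSet.iInter fun i => MeasurableSet.iInter fun _ =>
      measurableSet_eq_fun (measurable_residualTime.comp (measurable_stepFun.iterate i))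
        measurable_const
  have hn : ∀ n, renewalMeasure q {ω | ∀ i ≤ n, residualTime (stepFun^[i] ω) = y i}
      = (∫⁻ x : (ℕ → ℕ) × ℕ × ℕ, (if x.2.2 = y 0 then 1 else 0) ∂(iidMeasure q).prod (ageMeasure q))
        * ∏ i ∈ Finset.range n, renewalTransition q (y i) (y (i + 1)) := fun n => by
    rw [renewalMeasure, Measure.prod_apply (hm n), ← lintegral_mul_const]
    · exact lintegral_congr fun x => iidMeasure_path q n y x
    · exact Measurable.ite (measurableSet_eq_fun (by fun_prop) (by fun_prop))
        measurable_const measurable_const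
  rw [coe_renewalShift, hn, hn, Finset.prod_range_succ, mul_assoc]

/-! ## The centred renewal indicator -/

/-- The centred indicator of a renewal at the present time. -/
def renewalObs (q : PMF ℕ) (ω : RenewalSpace) : ℝ :=
  (residualTime ⁻¹' {0}).indicator 1 ω - (renewalMeasure q).real (residualTime ⁻¹' {0})

lemma measureReal_residualTime_zero (q : PMF ℕ) :
    (renewalMeasure q).real (residualTime ⁻¹' {0}) = (meanGap q)⁻¹.toReal := by
  have h := lintegral_residualTime q zeroInd
  have h1 : ∀ j : ℕ, ∑ k ∈ Finset.range (j + 1), zeroInd k = 1 := fun j => by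
    rw [Finset.sum_range_succ']
    simp [zeroInd]
  have h2 : ∀ ω, zeroInd (residualTime ω) = (residualTime ⁻¹' {0}).indicator 1 ω := fun ω => by
    rcases hk : residualTime ω with _ | k <;> simp [zeroInd, Set.indicator, hk]
  simp only [h1, mul_one, q.tsum_coe, h2] at h
  rw [lintegral_indicator_one (measurable_residualTime (measurableSet_singleton 0))] at h
  rw [Measure.real, h]

lemma renewalObs_eq (q : PMF ℕ) (ω : RenewalSpace) :
    renewalObs q ω = (zeroInd (residualTime ω)).toReal - (meanGap q)⁻¹.toReal := by
  rw [renewalObs, measureReal_residualTime_zero]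
  rcases hk : residualTime ω with _ | k <;> simp [zeroInd, Set.indicator, hk]

lemma renewalObs_eq_neg (q : PMF ℕ) {ω : RenewalSpace} (h : residualTime ω ≠ 0) :
    renewalObs q ω = -(meanGap q)⁻¹.toReal := by
  rw [renewalObs_eq]
  obtain ⟨k, hk⟩ := Nat.exists_eq_succ_of_ne_zero h
  simp [hk, zeroInd]

lemma measurable_renewalObs (q : PMF ℕ) : Measurable (renewalObs q) :=
  (measurable_one.indicator (measurable_residualTime (measurableSet_singleton 0))).sub_const _

lemma measurable_pastAlgebra_renewalObs (q : PMF ℕ) : Measurable[pastAlgebra] (renewalObs q) := by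
  have h : Measurable fun x : (ℕ → ℕ) × ℕ × ℕ =>
      (zeroInd x.2.2).toReal - (meanGap q)⁻¹.toReal := by
    have : Measurable fun k : ℕ => (zeroInd k).toReal - (meanGap q)⁻¹.toReal :=
      Measurable.of_discrete
    exact this.comp measurable_snd.snd
  have h2 : renewalObs q = (fun x : (ℕ → ℕ) × ℕ × ℕ =>
      (zeroInd x.2.2).toReal - (meanGap q)⁻¹.toReal) ∘ Prod.fst :=
    funext fun ω => renewalObs_eq q ω
  rw [h2]
  exact h.comp (comap_measurable Prod.fst)

lemma memLp_renewalObs (q : PMF ℕ) (hq : meanGap q ≠ ∞) (p : ℝ≥0∞) :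
    MemLp (renewalObs q) p (renewalMeasure q) := by
  have := isProbabilityMeasure_renewalMeasure q hq
  exact (memLp_indicator_const p (measurable_residualTime (measurableSet_singleton 0)) (1 : ℝ)
    (Or.inr (measure_ne_top _ _))).sub (memLp_const _)

lemma condExp_birkhoffSum_renewalObs (q : PMF ℕ) (hq : meanGap q ≠ ∞) (n : ℕ) :
    (renewalMeasure q)[birkhoffSum renewalShift (renewalObs q) n | pastAlgebra]
      =ᵐ[renewalMeasure q] fun ω =>
        ∑ i ∈ Finset.range n, ((transOp q)^[i] zeroInd (residualTime ω)).toReal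
          - n * (meanGap q)⁻¹.toReal := by
  have := isProbabilityMeasure_ageMeasure q hq
  have hp := isProbabilityMeasure_renewalMeasure q hq
  have hi : ∀ i, Integrable (fun ω => renewalObs q (stepFun^[i] ω)) (renewalMeasure q) := fun i =>
    (((measurePreserving_renewalShift q).iterate i).integrable_comp
      (measurable_renewalObs q).aestronglyMeasurable).2
      (memLp_one_iff_integrable.1 (memLp_renewalObs q hq 1))
  have hI : Integrable (birkhoffSum renewalShift (renewalObs q) n) (renewalMeasure q) :=
    integrable_finsetSum _ fun i _ => hi i
  refine (condExp_comap_fst_prod _ _ hI).trans (Eventually.of_forall fun ω => ?_)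
  have hz : ∀ i (x : (ℕ → ℕ) × ℕ × ℕ), Measurable fun v : ℕ → ℕ =>
      zeroInd (residualTime (stepFun^[i] (x, v))) := fun i x =>
    (Measurable.of_discrete (f := zeroInd)).comp (measurable_residualTime.comp
      ((measurable_stepFun.iterate i).comp (measurable_prodMk_left (x := x))))
  have hfin : ∀ k, zeroInd k < ∞ := fun k => by cases k <;> simp [zeroInd]
  have hle : ∀ k, (zeroInd k).toReal ≤ 1 := fun k => by cases k <;> simp [zeroInd]
  have hint : ∀ i, Integrable (fun v => (zeroInd (residualTime (stepFun^[i] (ω.1, v)))).toReal)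
      (iidMeasure q) := fun i =>
    Integrable.of_bound (hz i ω.1).ennreal_toReal.aestronglyMeasurable 1
      (Eventually.of_forall fun v => by
        rw [Real.norm_of_nonneg ENNReal.toReal_nonneg]; exact hle _)
  calc ∫ v, birkhoffSum renewalShift (renewalObs q) n (ω.1, v) ∂iidMeasure q
      = ∫ v, ∑ i ∈ Finset.range n, ((zeroInd (residualTime (stepFun^[i] (ω.1, v)))).toReal
          - (meanGap q)⁻¹.toReal) ∂iidMeasure q := by
        simp only [birkhoffSum, renewalObs_eq, coe_renewalShift]
    _ = ∑ i ∈ Finset.range n, (((transOp q)^[i] zeroInd (residualTime ω)).toReal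
          - (meanGap q)⁻¹.toReal) := by
        have hsub : ∀ i, Integrable (fun v => (zeroInd (residualTime (stepFun^[i] (ω.1, v)))).toReal
            - (meanGap q)⁻¹.toReal) (iidMeasure q) := fun i => (hint i).sub (integrable_const _)
        rw [integral_finsetSum _ fun i _ => hsub i]
        refine Finset.sum_congr rfl fun i _ => ?_
        rw [integral_sub (hint i) (integrable_const _), integral_toReal (hz i ω.1).aemeasurable
          (Eventually.of_forall fun _ => hfin _), lintegral_residualTime_iterate]
        simp [residualTime]
    _ = _ := by simp [Finset.sum_sub_distrib]

/-- Minkowski's inequality for the pointwise bound min(k, n) + D G. In the stationary mean of min(k,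
n)^p each of the j + 1 values k ≤ j is replaced by j, and the factor 1 / G ≤ 1 is dropped. -/
lemma eLpNorm_condExp_birkhoffSum_le (q : PMF ℕ) (hq : meanGap q ≠ ∞) (hD : meanResidual q ≠ ∞)
    (n : ℕ) {p : ℝ} (hp : 1 ≤ p) :
    eLpNorm ((renewalMeasure q)[birkhoffSum renewalShift (renewalObs q) n | pastAlgebra])
        (ENNReal.ofReal p) (renewalMeasure q)
      ≤ (∑' j, q j * ((j + 1) * (min j n : ℕ) ^ p)) ^ (1 / p) + meanResidual q * meanGap q := by
  have hP := isProbabilityMeasure_renewalMeasure q hq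
  set C := meanResidual q * meanGap q
  have hC : C ≠ ∞ := ENNReal.mul_ne_top hD hq
  have hp0 : 0 < p := by linarith
  have hp1 : 1 ≤ ENNReal.ofReal p := by simpa using hp
  have hm : Measurable fun ω : RenewalSpace => ((min (residualTime ω) n : ℕ) : ℝ) := by
    have : Measurable fun k : ℕ => ((min k n : ℕ) : ℝ) := Measurable.of_discrete
    exact this.comp measurable_residualTime
  calc _ ≤ eLpNorm ((fun ω => ((min (residualTime ω) n : ℕ) : ℝ)) + fun _ => C.toReal)
        (ENNReal.ofReal p) (renewalMeasure q) := by
        refine eLpNorm_mono_ae_real ?_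
        filter_upwards [condExp_birkhoffSum_renewalObs q hq n] with ω hω
        rw [hω]
        exact abs_sum_transOp_sub_le q hq hD n _
    _ ≤ eLpNorm (fun ω => ((min (residualTime ω) n : ℕ) : ℝ)) (ENNReal.ofReal p) (renewalMeasure q)
        + eLpNorm (fun _ => C.toReal) (ENNReal.ofReal p) (renewalMeasure q) :=
        eLpNorm_add_le hm.aestronglyMeasurable aestronglyMeasurable_const hp1
    _ ≤ _ := by
        gcongr
        · rw [eLpNorm_eq_lintegral_rpow_enorm_toReal (by positivity) ENNReal.ofReal_ne_top,
            ENNReal.toReal_ofReal hp0.le]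
          gcongr
          have he : ∀ ω, ‖((min (residualTime ω) n : ℕ) : ℝ)‖ₑ ^ p
              = (fun k : ℕ => ((min k n : ℕ) : ℝ≥0∞) ^ p) (residualTime ω) := fun ω => by
            rw [Real.enorm_of_nonneg (Nat.cast_nonneg _), ENNReal.ofReal_natCast]
          simp only [he]
          rw [lintegral_residualTime q fun k : ℕ => ((min k n : ℕ) : ℝ≥0∞) ^ p]
          calc _ ≤ 1 * ∑' j, q j * ∑ k ∈ Finset.range (j + 1), ((min k n : ℕ) : ℝ≥0∞) ^ p := by
                gcongr
                exact ENNReal.inv_le_one.2 (one_le_meanGap q)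
            _ ≤ _ := by
                rw [one_mul]
                refine ENNReal.tsum_le_tsum fun j => ?_
                gcongr
                calc _ ≤ ∑ k ∈ Finset.range (j + 1), ((min j n : ℕ) : ℝ≥0∞) ^ p := by
                      refine Finset.sum_le_sum fun k hk => ?_
                      have : k ≤ j := Nat.lt_succ_iff.1 (Finset.mem_range.1 hk)
                      gcongr
                  _ = _ := by simp
        · rw [eLpNorm_const _ (by positivity) (IsProbabilityMeasure.ne_zero _), measure_univ,
            ENNReal.one_rpow, mul_one, Real.enorm_of_nonneg ENNReal.toReal_nonneg,
            ENNReal.ofReal_toReal hC]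

/-- With `meanGap_le`, this reduces all finiteness requirements on `q` to a second moment. -/
lemma meanResidual_le (q : PMF ℕ) : meanResidual q ≤ ∑' j, q j * ((j : ℝ≥0∞) + 1) ^ 2 := by
  rw [meanResidual, lintegral_residualTime q fun k => (k : ℝ≥0∞)]
  calc _ ≤ 1 * ∑' j, q j * ∑ k ∈ Finset.range (j + 1), (k : ℝ≥0∞) := by
        gcongr
        exact ENNReal.inv_le_one.2 (one_le_meanGap q)
    _ ≤ _ := by
        rw [one_mul]
        refine ENNReal.tsum_le_tsum fun j => ?_
        gcongr
        calc _ ≤ ∑ k ∈ Finset.range (j + 1), ((j : ℝ≥0∞) + 1) := by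
              refine Finset.sum_le_sum fun k hk => ?_
              exact_mod_cast (Finset.mem_range.1 hk).le
          _ = _ := by simp [sq, mul_add]

lemma meanGap_le (q : PMF ℕ) : meanGap q ≤ ∑' j, q j * ((j : ℝ≥0∞) + 1) ^ 2 := by
  refine ENNReal.tsum_le_tsum fun j => ?_
  gcongr
  exact le_self_pow₀ (by simp) two_ne_zero

/-! ## Long gaps force large Hölder norms -/

lemma stepFun_iterate_residual (u v : ℕ → ℕ) (r k : ℕ) :
    stepFun^[k] ((u, r, k), v) = ((u, r + k, 0), v) := by
  induction k generalizing r with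
  | zero => rfl
  | succ k ih => rw [Function.iterate_succ_apply, stepFun_succ, ih, add_right_comm, add_assoc]

lemma residualTime_iterate {i : ℕ} {ω : RenewalSpace} (h : i ≤ residualTime ω) :
    residualTime (stepFun^[i] ω) = residualTime ω - i := by
  induction i generalizing ω with
  | zero => rfl
  | succ i ih =>
    obtain ⟨⟨u, r, _ | k⟩, v⟩ := ω
    · simp [residualTime] at h
    · have h' : i + 1 ≤ k + 1 := h
      rw [Function.iterate_succ_apply, stepFun_succ, ih (by change i ≤ k; omega)]
      change k - i = k + 1 - (i + 1)
      omega

/-- A gap `L` among the first `m` future gaps is seen by the residual time. -/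
lemma exists_residualTime_eq {L m N : ℕ} (ω : RenewalSpace) (hL : ∃ l < m, ω.2 l = L)
    (hN : residualTime ω + ∑ i ∈ Finset.range m, (ω.2 i + 1) ≤ N) :
    ∃ j, j + L ≤ N ∧ residualTime (stepFun^[j] ω) = L := by
  induction m generalizing ω N with
  | zero => obtain ⟨l, hl, -⟩ := hL; omega
  | succ m ih =>
    obtain ⟨⟨u, r, k⟩, v⟩ := ω
    have hk : stepFun^[k + 1] ((u, r, k), v) = ((consSeq (r + k) u, 0, v 0), tailSeq v) := by
      rw [Function.iterate_succ_apply', stepFun_iterate_residual, stepFun_zero]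
    rw [Finset.sum_range_succ'] at hN
    change k + _ ≤ N at hN
    simp only at hN
    obtain ⟨l, hl, hlL⟩ := hL
    change v l = L at hlL
    cases l with
    | zero => exact ⟨k + 1, by omega, by rw [hk]; exact hlL⟩
    | succ l =>
      obtain ⟨j, hj, hjL⟩ := ih (N := N - (k + 1)) ((consSeq (r + k) u, 0, v 0), tailSeq v)
        ⟨l, by omega, hlL⟩ (by
          change v 0 + ∑ i ∈ Finset.range m, (v (i + 1) + 1) ≤ _
          omega)
      refine ⟨j + (k + 1), by omega, ?_⟩
      rw [Function.iterate_add_apply, hk, hjL]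

/-- At times j, …, j + L - 1 the residual time runs through L, …, 1 and never vanishes, so the
observable equals -1 / G throughout. -/
lemma birkhoffSum_renewalObs_gap (q : PMF ℕ) {j L : ℕ} {ω : RenewalSpace}
    (h : residualTime (stepFun^[j] ω) = L) :
    birkhoffSum stepFun (renewalObs q) (j + L) ω
      = birkhoffSum stepFun (renewalObs q) j ω - L * (meanGap q)⁻¹.toReal := by
  rw [birkhoffSum_add]
  have : birkhoffSum stepFun (renewalObs q) L (stepFun^[j] ω)
      = ∑ _i ∈ Finset.range L, -(meanGap q)⁻¹.toReal := by
    refine Finset.sum_congr rfl fun i hi => renewalObs_eq_neg q ?_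
    have hi' := Finset.mem_range.1 hi
    rw [residualTime_iterate (by omega)]
    omega
  rw [this]
  simp
  ring

lemma partialSumProcess_div {Ω : Type*} (T : Ω → Ω) (f : Ω → ℝ) {n i : ℕ} (hn : n ≠ 0) (ω : Ω)
    (t : I) (ht : (t : ℝ) = i / n) : partialSumProcess T f n ω t = birkhoffSum T f i ω := by
  have h : (n : ℝ) * t = i := by
    rw [ht]; field_simp
  simp [partialSumProcess, h]

lemma HolderSpace.abs_sub_le {α : ℝ≥0} (x : HolderSpace α) (s t : I) :
    |x s - x t| ≤ ‖x‖ * |(s : ℝ) - t| ^ (α : ℝ) := by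
  have h := x.memHolder.holderWith.dist_le s t
  rw [Real.dist_eq, Subtype.dist_eq, Real.dist_eq] at h
  refine h.trans ?_
  gcongr
  rw [HolderSpace.norm_def]
  linarith [abs_nonneg (x 0)]

/-- The Hölder quotient is tested at the two endpoints j / N and (j + L) / N of the gap. -/
lemma le_norm_holderPartialSum (q : PMF ℕ) {p : ℝ} (hp : 2 < p) {j L N : ℕ} (hL : 1 ≤ L)
    (hN : j + L ≤ N) {ω : RenewalSpace} (h : residualTime (stepFun^[j] ω) = L) :
    (meanGap q)⁻¹.toReal * ((L : ℝ) ^ (1 + p / 2) / N) ^ (1 / p)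
      ≤ ‖(N : ℝ) ^ (-(1 / 2) : ℝ) •
        holderPartialSum (holderExponent_le_one hp) stepFun (renewalObs q) N ω‖ := by
  have hN0 : N ≠ 0 := by omega
  have hNpos : (0 : ℝ) < N := by exact_mod_cast Nat.pos_of_ne_zero hN0
  have hLpos : (0 : ℝ) < L := by exact_mod_cast hL
  have hjN : ((j + L : ℕ) : ℝ) ≤ N := by exact_mod_cast hN
  have hc : 0 ≤ (meanGap q)⁻¹.toReal := ENNReal.toReal_nonneg
  have hjN' : (j : ℝ) ≤ N := by exact_mod_cast (by omega : j ≤ N)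
  let s : I := ⟨((j + L : ℕ) : ℝ) / N, by positivity, (div_le_one hNpos).2 hjN⟩
  let t : I := ⟨(j : ℝ) / N, by positivity, (div_le_one hNpos).2 hjN'⟩
  have hst : |(s : ℝ) - t| = L / N := by
    have : (s : ℝ) - t = L / N := by simp only [s, t]; push_cast; ring
    rw [this, abs_of_pos (by positivity)]
  set x := (N : ℝ) ^ (-(1 / 2) : ℝ) •
    holderPartialSum (holderExponent_le_one hp) stepFun (renewalObs q) N ω
  have hx : ∀ r : I, x r = (N : ℝ) ^ (-(1 / 2) : ℝ)
      * partialSumProcess stepFun (renewalObs q) N ω r := fun r => rfl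
  have hα : (holderExponent p : ℝ) = 1 / 2 - 1 / p := by
    refine Real.coe_toNNReal _ ?_
    have : 1 / p < 1 / 2 := one_div_lt_one_div_of_lt two_pos hp
    linarith
  have key := x.abs_sub_le s t
  rw [hx, hx, partialSumProcess_div _ _ hN0 ω s rfl, partialSumProcess_div _ _ hN0 ω t rfl,
    birkhoffSum_renewalObs_gap q h, ← mul_sub, sub_sub_cancel_left, hst, hα, abs_mul, abs_neg,
    abs_of_nonneg (by positivity : 0 ≤ (N : ℝ) ^ (-(1 / 2) : ℝ)),
    abs_of_nonneg (mul_nonneg hLpos.le hc)] at key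
  have hp0 : p ≠ 0 := by positivity
  have e1 : ((L : ℝ) ^ (1 + p / 2) / N) ^ (1 / p)
      = (N : ℝ) ^ (-(1 / 2) : ℝ) * L / ((L : ℝ) / N) ^ (1 / 2 - 1 / p) := by
    rw [Real.div_rpow (by positivity) hNpos.le, ← Real.rpow_mul hLpos.le,
      Real.div_rpow hLpos.le hNpos.le, div_div_eq_mul_div, div_eq_div_iff (by positivity)
      (by positivity)]
    have a1 : (L : ℝ) ^ ((1 + p / 2) * (1 / p)) * L ^ (1 / 2 - 1 / p) = L := by
      rw [← Real.rpow_add hLpos]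
      have : (1 + p / 2) * (1 / p) + (1 / 2 - 1 / p) = 1 := by field_simp; ring
      rw [this, Real.rpow_one]
    have a2 : (N : ℝ) ^ (-(1 / 2) : ℝ) * N ^ (1 / 2 - 1 / p) * N ^ (1 / p) = 1 := by
      rw [← Real.rpow_add hNpos, ← Real.rpow_add hNpos]
      have : -(1 / 2) + (1 / 2 - 1 / p) + 1 / p = 0 := by ring
      rw [this, Real.rpow_zero]
    rw [a1]
    linear_combination -(L : ℝ) * a2
  rw [e1, mul_div_assoc', div_le_iff₀ (by positivity)]
  linarith

/-! ## Long gaps occur with positive probability -/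

lemma one_sub_pow_le_half {x : ℝ} (hx1 : x ≤ 1) {m : ℕ} (hm : 1 ≤ m * x) :
    (1 - x) ^ m ≤ 1 / 2 := by
  calc (1 - x) ^ m ≤ Real.exp (-x) ^ m :=
        pow_le_pow_left₀ (by linarith) (Real.one_sub_le_exp_neg x) m
    _ = Real.exp (-(m * x)) := by rw [← Real.exp_nat_mul]; ring_nf
    _ ≤ Real.exp (-1) := Real.exp_le_exp.2 (by linarith)
    _ ≤ 1 / 2 := by
        rw [Real.exp_neg, one_div]
        exact inv_anti₀ two_pos (by linarith [Real.add_one_le_exp 1])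

lemma lintegral_gap (q : PMF ℕ) (i : ℕ) :
    ∫⁻ v, ((v i : ℝ≥0∞) + 1) ∂iidMeasure q = meanGap q := by
  rw [meanGap, ← lintegral_pmf]
  exact (measurePreserving_eval_infinitePi (fun _ : ℕ => q.toMeasure) i).lintegral_comp
    (f := fun j : ℕ => (j : ℝ≥0∞) + 1) Measurable.of_discrete

/-- The event can fail in two ways only. Either none of the first m future gaps equals L, with
probability (1 - q(L))^m ≤ 1/2; or these gaps are not over before time N, with probability at most
1/4 by Markov's inequality. -/
lemma quarter_le_measure_gap (q : PMF ℕ) (hq : meanGap q ≠ ∞) {L m N : ℕ}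
    (hm : 1 ≤ m * (q L).toReal) (hN0 : N ≠ 0)
    (hN : 4 * (meanResidual q + m * meanGap q) ≤ N) :
    1 / 4 ≤ renewalMeasure q
      {ω | ∃ j, j + L ≤ N ∧ residualTime (stepFun^[j] ω) = L} := by
  have hA := isProbabilityMeasure_ageMeasure q hq
  have hP := isProbabilityMeasure_renewalMeasure q hq
  set E := {ω : RenewalSpace | ∃ j, j + L ≤ N ∧ residualTime (stepFun^[j] ω) = L}
  set A := {ω : RenewalSpace | ∀ l < m, ω.2 l ≠ L}
  set B := {ω : RenewalSpace | (N : ℝ≥0∞)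
    ≤ residualTime ω + ∑ i ∈ Finset.range m, ((ω.2 i : ℝ≥0∞) + 1)}
  have hcover : Set.univ ⊆ E ∪ (A ∪ B) := by
    intro ω _
    by_cases hA : ω ∈ A
    · exact Or.inr (Or.inl hA)
    by_cases hB : ω ∈ B
    · exact Or.inr (Or.inr hB)
    left
    refine exists_residualTime_eq (m := m) ω (by simpa [A] using hA) ?_
    have : residualTime ω + ∑ i ∈ Finset.range m, ((ω.2 i : ℝ≥0∞) + 1) < N := by
      simpa [B] using hB
    exact_mod_cast this.le
  have hμA : renewalMeasure q A ≤ 1 / 2 := by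
    have h1 : A = Prod.snd ⁻¹' ((Finset.range m : Set ℕ).pi fun _ => ({L}ᶜ : Set ℕ)) := by
      ext ω; simp [A]
    have hq1 : q L ≤ 1 := q.coe_le_one L
    have hqt : q L ≠ ∞ := ne_top_of_le_ne_top ENNReal.one_ne_top hq1
    rw [h1, renewalMeasure, measurePreserving_snd.measure_preimage
      (MeasurableSet.pi (Finset.range m).countable_toSet
        fun _ _ => MeasurableSet.of_discrete).nullMeasurableSet,
      iidMeasure, Measure.infinitePi_pi _ fun _ _ => MeasurableSet.of_discrete]
    rw [Finset.prod_const, Finset.card_range, prob_compl_eq_one_sub (measurableSet_singleton L),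
      PMF.toMeasure_apply_singleton _ _ (measurableSet_singleton L)]
    have h2 : 1 - q L = ENNReal.ofReal (1 - (q L).toReal) := by
      rw [ENNReal.ofReal_sub _ ENNReal.toReal_nonneg, ENNReal.ofReal_one, ENNReal.ofReal_toReal hqt]
    have hx1 : (q L).toReal ≤ 1 := by
      rw [← ENNReal.toReal_one]; exact ENNReal.toReal_mono ENNReal.one_ne_top hq1
    rw [h2, ← ENNReal.ofReal_pow (by linarith)]
    refine (ENNReal.ofReal_le_ofReal (one_sub_pow_le_half hx1 hm)).trans_eq ?_
    rw [ENNReal.ofReal_div_of_pos two_pos]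
    simp
  have hμB : renewalMeasure q B ≤ 1 / 4 := by
    have hm1 : Measurable fun ω : RenewalSpace => (residualTime ω : ℝ≥0∞) :=
      (Measurable.of_discrete (f := fun k : ℕ => (k : ℝ≥0∞))).comp measurable_residualTime
    have hm2 : ∀ i, Measurable fun v : ℕ → ℕ => (v i : ℝ≥0∞) + 1 := fun i =>
      (Measurable.of_discrete (f := fun k : ℕ => (k : ℝ≥0∞) + 1)).comp (measurable_pi_apply i)
    have hm3 : ∀ i, Measurable fun ω : RenewalSpace => (ω.2 i : ℝ≥0∞) + 1 := fun i =>
      (hm2 i).comp measurable_snd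
    have hint : ∫⁻ ω, (residualTime ω + ∑ i ∈ Finset.range m, ((ω.2 i : ℝ≥0∞) + 1))
        ∂renewalMeasure q = meanResidual q + m * meanGap q := by
      rw [lintegral_add_left hm1, lintegral_finsetSum _ fun i _ => hm3 i]
      congr 1
      have hi : ∀ i, ∫⁻ ω : RenewalSpace, ((ω.2 i : ℝ≥0∞) + 1) ∂renewalMeasure q = meanGap q :=
        fun i => (measurePreserving_snd.lintegral_comp (hm2 i)).trans (lintegral_gap q i)
      simp only [hi, Finset.sum_const, Finset.card_range, nsmul_eq_mul]
    have hmk := mul_meas_ge_le_lintegral (μ := renewalMeasure q)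
      (hm1.add (Finset.measurable_sum (Finset.range m) fun i _ => hm3 i))
      (N : ℝ≥0∞)
    have hmk' : (N : ℝ≥0∞) * renewalMeasure q B ≤ meanResidual q + m * meanGap q := by
      rw [← hint]
      refine le_trans (le_of_eq ?_) (hmk.trans (le_of_eq ?_))
      · simp [B]
      · simp
    have h3 : (N : ℝ≥0∞) * (4 * renewalMeasure q B) ≤ N * 1 := by
      calc (N : ℝ≥0∞) * (4 * renewalMeasure q B) = 4 * (N * renewalMeasure q B) := by ring
        _ ≤ 4 * (meanResidual q + m * meanGap q) := by gcongr
        _ ≤ N * 1 := by rwa [mul_one]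
    have h4 := (ENNReal.mul_le_mul_iff_right (by exact_mod_cast hN0)
      (ENNReal.natCast_ne_top N)).1 h3
    rw [ENNReal.le_div_iff_mul_le (by simp) (by simp), mul_comm]
    exact h4
  have h1 : (1 : ℝ≥0∞) ≤ renewalMeasure q E + (1 / 2 + 1 / 4) := by
    calc (1 : ℝ≥0∞) = renewalMeasure q Set.univ := measure_univ.symm
      _ ≤ renewalMeasure q (E ∪ (A ∪ B)) := measure_mono hcover
      _ ≤ renewalMeasure q E + (renewalMeasure q A + renewalMeasure q B) :=
          (measure_union_le _ _).trans (by gcongr; exact measure_union_le _ _)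
      _ ≤ _ := by gcongr
  have hE : renewalMeasure q E ≠ ∞ := measure_ne_top _ _
  have h2 := ENNReal.toReal_mono (by finiteness) h1
  rw [ENNReal.toReal_add hE (by finiteness), ENNReal.toReal_add (by finiteness) (by finiteness)] at h2
  rw [← ENNReal.toReal_le_toReal (by finiteness) hE]
  simp at h2 ⊢
  linarith

/-! ## Failure of tightness -/

/-- The Borel σ-algebra of the Hölder norm may exceed the one generated by evaluations, so the path
is factored through finitely many real coordinates and a continuous linear map `Φ`. -/
lemma measurable_smul_holderPartialSum {Ω : Type*} [MeasurableSpace Ω] {α : ℝ≥0} (hα : α ≤ 1)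
    {T : Ω → Ω} (hT : Measurable T) {f : Ω → ℝ} (hf : Measurable f) (n : ℕ) (c : ℝ) :
    Measurable fun ω => c • holderPartialSum hα T f n ω := by
  let h : ℕ → I → ℝ := fun k t => max 0 (min 1 ((n : ℝ) * (t : ℝ) - k))
  have hmem : ∀ k, MemHolder α (h k) := fun k => by
    have hL : LipschitzWith n (h k) := by
      refine LipschitzWith.const_max (LipschitzWith.const_min ?_ 1) 0
      refine LipschitzWith.of_dist_le_mul fun s t => ?_
      rw [Real.dist_eq, Subtype.dist_eq, Real.dist_eq]
      have : (n : ℝ) * (s : ℝ) - k - (n * (t : ℝ) - k) = n * ((s : ℝ) - t) := by ring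
      rw [this, abs_mul, Nat.abs_cast]
      simp
    exact (holderWith_one.2 hL).memHolder.of_le hα
  let H : ℕ → HolderSpace α := fun k => HolderSpace.mk (h k) (hmem k)
  let Φ : (Fin (n + 1) → ℝ) → HolderSpace α := fun c => ∑ k : Fin (n + 1), c k • H k
  have hΦ : Continuous Φ := by fun_prop
  have key : ∀ ω, holderPartialSum hα T f n ω = Φ fun k => f (T^[k] ω) := by
    intro ω
    ext t
    have h0 : 0 ≤ (n : ℝ) * (t : ℝ) := mul_nonneg (Nat.cast_nonneg n) t.2.1
    have h1 : ⌊(n : ℝ) * (t : ℝ)⌋₊ < n + 1 :=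
      Nat.lt_succ_of_le (Nat.floor_le_of_le (mul_le_of_le_one_right (Nat.cast_nonneg n) t.2.2))
    have h2 := polygonal_eq_sum_clamp (fun k => f (T^[k] ω)) (n + 1) _ h0 h1
    have h3 : (Φ fun k => f (T^[k] ω)) t = ∑ k : Fin (n + 1), f (T^[k] ω) * h k t := by
      let ev : HolderSpace α →+ ℝ :=
        { toFun := fun x => x t, map_zero' := rfl, map_add' := fun _ _ => rfl }
      exact map_sum ev _ _
    rw [h3, Fin.sum_univ_eq_sum_range (fun k => f (T^[k] ω) * h k t), ← h2]
    rfl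
  simp only [key]
  exact (hΦ.measurable.comp (measurable_pi_iff.2 fun k => hf.comp (hT.iterate k))).const_smul c

lemma not_isTightMeasureSet_holderPartialSum (q : PMF ℕ) (hq : meanGap q ≠ ∞)
    (hD : meanResidual q ≠ ∞) {p : ℝ} (hp : 2 < p)
    (hH : ∀ K : ℝ, ∃ L : ℕ, 1 ≤ L ∧ K ≤ (L : ℝ) ^ (1 + p / 2) * (q L).toReal) :
    ¬ IsTightMeasureSet {ν : Measure (HolderSpace (holderExponent p)) | ∃ n : ℕ, 1 ≤ n ∧
      ν = (renewalMeasure q).map fun ω => (n : ℝ) ^ (-(1 / 2) : ℝ) •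
        holderPartialSum (holderExponent_le_one hp) renewalShift (renewalObs q) n ω} := by
  intro ht
  -- Any level below the 1/4 of `quarter_le_measure_gap` would do. Compactness of `S` is used
  -- through its boundedness in norm.
  obtain ⟨S, hS, hSt⟩ := isTightMeasureSet_iff_exists_isCompact_measure_compl_le.1 ht (1 / 8)
    (by simp)
  obtain ⟨R, hR0, hR⟩ := hS.isBounded.exists_pos_norm_le
  set G := (meanGap q).toReal
  set D := (meanResidual q).toReal
  have hG : 1 ≤ G := by
    rw [← ENNReal.toReal_one]
    exact ENNReal.toReal_mono hq (one_le_meanGap q)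
  have hD0 : 0 ≤ D := ENNReal.toReal_nonneg
  -- Bounds N x below: N < 4 (D + m G) + 1, while m x ≤ 2 and x ≤ 1.
  set C := 4 * D + 8 * G + 1
  have hC : 0 < C := by positivity
  have hp0 : 0 < p := by linarith
  obtain ⟨L, hL1, hL⟩ := hH (C * ((R + 1) * G) ^ p)
  set x := (q L).toReal
  have hLpos : (0 : ℝ) < L := by exact_mod_cast hL1
  have hx : 0 < x := by
    have h1 : 0 < (L : ℝ) ^ (1 + p / 2) * x := lt_of_lt_of_le (by positivity) hL
    exact pos_of_mul_pos_right h1 (by positivity)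
  have hx1 : x ≤ 1 := by
    rw [← ENNReal.toReal_one]
    exact ENNReal.toReal_mono ENNReal.one_ne_top (q.coe_le_one L)
  set m := ⌈1 / x⌉₊
  have hm1 : 1 / x ≤ m := Nat.le_ceil _
  have hm2 : (m : ℝ) < 1 / x + 1 := Nat.ceil_lt_add_one (by positivity)
  set N := ⌈4 * (D + m * G)⌉₊
  have hN1 : 4 * (D + m * G) ≤ N := Nat.le_ceil _
  have hN2 : (N : ℝ) < 4 * (D + m * G) + 1 := Nat.ceil_lt_add_one (by positivity)
  have hmpos : (0 : ℝ) < m := lt_of_lt_of_le (by positivity) hm1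
  have hNpos : (0 : ℝ) < N := lt_of_lt_of_le (by positivity) hN1
  have hN0 : N ≠ 0 := by
    intro h; rw [h] at hNpos; simp at hNpos
  have hNx : (N : ℝ) * x ≤ C := by
    have h1 : m * x ≤ 2 := by
      have := mul_le_mul_of_nonneg_right hm2.le hx.le
      rw [add_mul, one_div, inv_mul_cancel₀ hx.ne'] at this
      linarith
    have h2 := mul_le_mul_of_nonneg_right hN2.le hx.le
    have h3 : m * x * G ≤ 2 * G := mul_le_mul_of_nonneg_right h1 (by linarith)
    have h4 : D * x ≤ D := mul_le_of_le_one_right hD0 hx1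
    simp only [C]
    nlinarith
  have hquarter := quarter_le_measure_gap q hq (L := L) (m := m) (N := N)
    (by rwa [div_le_iff₀ hx] at hm1) hN0 (by
      have : (4 * (meanResidual q + m * meanGap q)) = ENNReal.ofReal (4 * (D + m * G)) := by
        rw [ENNReal.ofReal_mul (by norm_num), ENNReal.ofReal_add hD0 (by positivity),
          ENNReal.ofReal_mul (by positivity), ENNReal.ofReal_toReal hq, ENNReal.ofReal_toReal hD,
          ENNReal.ofReal_natCast]
        norm_num
      rw [this, ← ENNReal.ofReal_natCast N]
      exact ENNReal.ofReal_le_ofReal hN1)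
  have hmeas := measurable_smul_holderPartialSum (holderExponent_le_one hp) measurable_stepFun
    (measurable_renewalObs q) N ((N : ℝ) ^ (-(1 / 2) : ℝ))
  have h8 := hSt _ ⟨N, Nat.one_le_iff_ne_zero.2 hN0, rfl⟩
  rw [coe_renewalShift, Measure.map_apply hmeas hS.measurableSet.compl] at h8
  have hsub : {ω : RenewalSpace | ∃ j, j + L ≤ N ∧ residualTime (stepFun^[j] ω) = L}
      ⊆ (fun ω => (N : ℝ) ^ (-(1 / 2) : ℝ) •
        holderPartialSum (holderExponent_le_one hp) stepFun (renewalObs q) N ω) ⁻¹' Sᶜ := by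
    rintro ω ⟨j, hj, hjL⟩ hωS
    have h1 := le_norm_holderPartialSum q hp hL1 hj hjL
    have h2 := h1.trans (hR _ hωS)
    have h3 : ((R + 1) * G) ^ p ≤ (L : ℝ) ^ (1 + p / 2) / N := by
      rw [le_div_iff₀ hNpos]
      refine le_of_mul_le_mul_right ?_ hx
      calc ((R + 1) * G) ^ p * N * x = ((R + 1) * G) ^ p * (N * x) := by ring
        _ ≤ ((R + 1) * G) ^ p * C := by gcongr
        _ ≤ _ := by linarith
    have h4 : (R + 1) * G ≤ ((L : ℝ) ^ (1 + p / 2) / N) ^ (1 / p) := by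
      calc (R + 1) * G = (((R + 1) * G) ^ p) ^ (1 / p) := by
            rw [← Real.rpow_mul (by positivity), mul_one_div_cancel hp0.ne', Real.rpow_one]
        _ ≤ _ := by gcongr
    have h5 : G⁻¹ * ((R + 1) * G) ≤ R := by
      refine le_trans ?_ h2
      rw [ENNReal.toReal_inv]
      gcongr
    have : G⁻¹ * ((R + 1) * G) = R + 1 := by
      have : G ≠ 0 := by positivity
      field_simp
    linarith
  have h9 := hquarter.trans ((measure_mono hsub).trans h8)
  rw [← ENNReal.toReal_le_toReal (by finiteness) (by finiteness)] at h9
  norm_num at h9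

/-! ## Weighted sums of truncations -/

lemma ENNReal.rpow_tsum_le {ι : Type*} (x : ι → ℝ≥0∞) {r : ℝ} (hr0 : 0 < r) (hr1 : r ≤ 1) :
    (∑' i, x i) ^ r ≤ ∑' i, x i ^ r := by
  rw [← ENNReal.le_rpow_inv_iff hr0]
  refine ENNReal.summable.tsum_le_of_sum_le fun s => ?_
  rw [ENNReal.le_rpow_inv_iff hr0]
  refine le_trans ?_ (ENNReal.sum_le_tsum s)
  exact Finset.le_sum_of_subadditive (fun y : ℝ≥0∞ => y ^ r) (ENNReal.zero_rpow_of_pos hr0).le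
    (fun a b => ENNReal.rpow_add_le_add_rpow a b hr0.le hr1) s x

lemma inv_sqrt_succ_le (n : ℕ) : 1 / √(n + 1 : ℝ) ≤ 2 * (√(n + 1 : ℝ) - √n) := by
  have h0 : (0 : ℝ) ≤ n := Nat.cast_nonneg n
  have h1 : 0 < √(n + 1 : ℝ) := Real.sqrt_pos.2 (by linarith)
  have h2 := Real.sq_sqrt h0
  have h3 := Real.sq_sqrt (by linarith : (0 : ℝ) ≤ n + 1)
  rw [div_le_iff₀ h1]
  nlinarith [sq_nonneg (√(n + 1 : ℝ) - √n)]

lemma inv_mul_sqrt_succ_le {n : ℕ} (hn : 1 ≤ n) :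
    1 / ((n + 1 : ℝ) * √(n + 1 : ℝ)) ≤ 2 * (1 / √n - 1 / √(n + 1 : ℝ)) := by
  have h0 : (1 : ℝ) ≤ n := by exact_mod_cast hn
  have h1 : 0 < √(n + 1 : ℝ) := Real.sqrt_pos.2 (by linarith)
  have h1' : 0 < √(n : ℝ) := Real.sqrt_pos.2 (by linarith)
  have h2 := Real.sq_sqrt (by linarith : (0 : ℝ) ≤ n)
  have h3 := Real.sq_sqrt (by linarith : (0 : ℝ) ≤ n + 1)
  have h4 : √(n : ℝ) ≤ √(n + 1 : ℝ) := Real.sqrt_le_sqrt (by linarith)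
  set s := √(n : ℝ)
  set t := √(n + 1 : ℝ)
  rw [← h3, div_sub_div _ _ h1'.ne' h1.ne', mul_div_assoc', div_le_div_iff₀ (by positivity)
    (by positivity)]
  have h5 : (t - s) * (t + s) = 1 := by nlinarith
  have h6 : s ≤ 2 * (t - s) * t ^ 2 := by
    have : 0 ≤ t - s := by linarith
    have h7 : 1 ≤ (t - s) * (2 * t) := by nlinarith
    nlinarith
  nlinarith

lemma rpow_three_halves (x : ℝ) (hx : 0 ≤ x) : x ^ (3 / 2 : ℝ) = x * √x := by
  rcases hx.eq_or_lt with rfl | hx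
  · simp
  · rw [Real.sqrt_eq_rpow, ← Real.rpow_one_add' hx.le (by norm_num)]
    norm_num

/-- Split at n = L: the terms n^(-1/2) up to L and the tail L n^(-3/2) each sum to at most 2√L by
telescoping. The term n = 0 is zero. -/
lemma sum_min_div_le {L : ℕ} (hL : 1 ≤ L) (N : ℕ) :
    ∑ n ∈ Finset.range N, ((min L n : ℕ) : ℝ) / (n : ℝ) ^ (3 / 2 : ℝ) ≤ 4 * √L := by
  have hLs : √(L : ℝ) * √L = L := Real.mul_self_sqrt (Nat.cast_nonneg L)
  have h1 : ∀ N ≤ L, ∑ n ∈ Finset.range (N + 1), ((min L n : ℕ) : ℝ) / (n : ℝ) ^ (3 / 2 : ℝ)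
      ≤ 2 * √N := by
    intro N hN
    induction N with
    | zero => simp
    | succ N ih =>
      rw [Finset.sum_range_succ, min_eq_right hN, rpow_three_halves _ (Nat.cast_nonneg _)]
      have h0 : ((N + 1 : ℕ) : ℝ) ≠ 0 := by positivity
      rw [div_mul_cancel_left₀ h0, ← one_div]
      have := inv_sqrt_succ_le N
      have hN' := ih (by omega)
      rw [← Nat.cast_succ] at this
      linarith
  -- The subtracted term carries the telescoping; at N = 0 the right side is 2√L, the bound from
  -- `h1`.
  have h2 : ∀ N, ∑ n ∈ Finset.range (L + N + 1), ((min L n : ℕ) : ℝ) / (n : ℝ) ^ (3 / 2 : ℝ)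
      ≤ 4 * √L - 2 * L / √(L + N : ℕ) := by
    intro N
    induction N with
    | zero =>
      refine (h1 L le_rfl).trans (le_of_eq ?_)
      have : √(L : ℝ) ≠ 0 := (Real.sqrt_pos.2 (by exact_mod_cast hL)).ne'
      rw [add_zero]
      field_simp
      rw [Real.sq_sqrt (Nat.cast_nonneg L)]
      ring
    | succ N ih =>
      rw [← add_assoc, Finset.sum_range_succ, min_eq_left (by omega),
        rpow_three_halves _ (Nat.cast_nonneg _)]
      have := mul_le_mul_of_nonneg_left (inv_mul_sqrt_succ_le (by omega : 1 ≤ L + N))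
        (Nat.cast_nonneg (α := ℝ) L)
      push_cast at this ih ⊢
      have e1 : (L : ℝ) / ((L + N + 1) * √(L + N + 1)) = L * (1 / ((L + N + 1) * √(L + N + 1))) := by
        ring
      have e2 : 2 * (L : ℝ) / √(L + N + 1) = L * (2 * (1 / √(L + N + 1))) := by ring
      have e3 : 2 * (L : ℝ) / √(L + N) = L * (2 * (1 / √(L + N))) := by ring
      rw [e3] at ih
      rw [e1, e2]
      linarith
  calc _ ≤ ∑ n ∈ Finset.range (L + N + 1), ((min L n : ℕ) : ℝ) / (n : ℝ) ^ (3 / 2 : ℝ) :=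
        Finset.sum_le_sum_of_subset_of_nonneg (Finset.range_mono (by omega))
          fun _ _ _ => by positivity
    _ ≤ _ := (h2 N).trans (sub_le_self _ (by positivity))

/-- The weighted sum `∑ b n n ^ (-3/2) min L n`. -/
def truncSum (b : ℕ → ℝ) (L : ℕ) : ℝ≥0∞ :=
  ∑' n : ℕ, ENNReal.ofReal (b n / (n : ℝ) ^ (3 / 2 : ℝ)) * (min L n : ℕ)

/-- The finitely many n with b n > ε contribute at most a constant independent of L, as min(L, n) ≤
n; the rest is ε times `sum_min_div_le`. -/
lemma truncSum_le {b : ℕ → ℝ} (hb0 : ∀ n, 0 ≤ b n) (hb : Tendsto b atTop (𝓝 0)) {ε : ℝ}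
    (hε : 0 < ε) : ∃ K : ℝ, 0 ≤ K ∧ ∀ L, 1 ≤ L → truncSum b L ≤ ENNReal.ofReal (K + 4 * ε * √L) := by
  obtain ⟨n₀, hn₀⟩ := eventually_atTop.1 (hb.eventually (ge_mem_nhds hε))
  refine ⟨∑ n ∈ Finset.range n₀, b n / (n : ℝ) ^ (3 / 2 : ℝ) * n,
    Finset.sum_nonneg fun n _ => by have := hb0 n; positivity, fun L hL => ?_⟩
  refine ENNReal.tsum_le_of_sum_range_le fun N => ?_
  have hterm : ∀ n, ENNReal.ofReal (b n / (n : ℝ) ^ (3 / 2 : ℝ)) * (min L n : ℕ)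
      = ENNReal.ofReal (b n / (n : ℝ) ^ (3 / 2 : ℝ) * (min L n : ℕ)) := fun n => by
    rw [ENNReal.ofReal_mul (by have := hb0 n; positivity), ENNReal.ofReal_natCast]
  simp only [hterm]
  rw [← ENNReal.ofReal_sum_of_nonneg fun n _ => by have := hb0 n; positivity]
  refine ENNReal.ofReal_le_ofReal ?_
  have hle : ∀ n, b n / (n : ℝ) ^ (3 / 2 : ℝ) * (min L n : ℕ)
      ≤ (if n < n₀ then b n / (n : ℝ) ^ (3 / 2 : ℝ) * n else 0)
        + ε * (((min L n : ℕ) : ℝ) / (n : ℝ) ^ (3 / 2 : ℝ)) := by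
    intro n
    have h0 := hb0 n
    split_ifs with h
    · have h1 : b n / (n : ℝ) ^ (3 / 2 : ℝ) * (min L n : ℕ) ≤ b n / (n : ℝ) ^ (3 / 2 : ℝ) * n := by
        gcongr
        exact min_le_right _ _
      have h2 : 0 ≤ ε * (((min L n : ℕ) : ℝ) / (n : ℝ) ^ (3 / 2 : ℝ)) := by positivity
      linarith
    · have h1 := hn₀ n (not_lt.1 h)
      rw [zero_add, div_mul_eq_mul_div, mul_div_assoc']
      gcongr
  calc _ ≤ ∑ n ∈ Finset.range N, ((if n < n₀ then b n / (n : ℝ) ^ (3 / 2 : ℝ) * n else 0)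
        + ε * (((min L n : ℕ) : ℝ) / (n : ℝ) ^ (3 / 2 : ℝ))) := Finset.sum_le_sum fun n _ => hle n
    _ ≤ _ := by
        rw [Finset.sum_add_distrib, ← Finset.mul_sum, ← Finset.sum_filter]
        have h1 := sum_min_div_le hL N
        have h2 : ∑ n ∈ Finset.range N with n < n₀, b n / (n : ℝ) ^ (3 / 2 : ℝ) * n
            ≤ ∑ n ∈ Finset.range n₀, b n / (n : ℝ) ^ (3 / 2 : ℝ) * n := by
          refine Finset.sum_le_sum_of_subset_of_nonneg (fun n hn => ?_)
            fun n _ _ => by have := hb0 n; positivity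
          exact Finset.mem_range.2 (Finset.mem_filter.1 hn).2
        nlinarith

/-- A gap length `L` so large that an atom of mass `R L ^ -(1 + p / 2)` at `L` contributes little. -/
lemma exists_gap_length {b : ℕ → ℝ} (hb0 : ∀ n, 0 ≤ b n) (hb : Tendsto b atTop (𝓝 0)) {p : ℝ}
    (hp : 2 < p) {R δ : ℝ} (hR : 0 < R) (hδ : 0 < δ) :
    ∃ L : ℕ, 1 ≤ L ∧ R * (L : ℝ) ^ (-(1 + p / 2)) * (L + 1) ^ 2 ≤ δ ∧
      ENNReal.ofReal (R * (L : ℝ) ^ (-(1 + p / 2)) * (L + 1)) ^ (1 / p) * truncSum b L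
        ≤ ENNReal.ofReal δ := by
  have hp0 : 0 < p := by linarith
  set A := (2 * R) ^ (1 / p)
  have hA : 0 < A := by positivity
  -- With this ε the critical part A L^(-1/2) · 4 ε √L equals δ / 2; the constant K is left to decay
  -- in `t2`.
  obtain ⟨K, hK0, hK⟩ := truncSum_le hb0 hb (ε := δ / (8 * A)) (by positivity)
  -- The second-moment requirement, and the place where p > 2 is essential.
  have t1 : Tendsto (fun L : ℕ => 4 * R * (L : ℝ) ^ (-(p / 2 - 1))) atTop (𝓝 0) := by
    have := ((tendsto_rpow_neg_atTop (by linarith : 0 < p / 2 - 1)).comp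
      tendsto_natCast_atTop_atTop).const_mul (4 * R)
    simpa using this
  have t2 : Tendsto (fun L : ℕ => A * K * (L : ℝ) ^ (-(1 / 2) : ℝ)) atTop (𝓝 0) := by
    have := ((tendsto_rpow_neg_atTop (by norm_num : (0 : ℝ) < 1 / 2)).comp
      tendsto_natCast_atTop_atTop).const_mul (A * K)
    simpa using this
  obtain ⟨L, h1, h2, hL⟩ := ((t1.eventually (ge_mem_nhds hδ)).and
    ((t2.eventually (ge_mem_nhds (half_pos hδ))).and (eventually_ge_atTop 1))).exists
  have hLpos : (0 : ℝ) < L := by exact_mod_cast hL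
  have hL1 : (1 : ℝ) ≤ L := by exact_mod_cast hL
  refine ⟨L, hL, le_trans ?_ h1, ?_⟩
  · have e : (L : ℝ) ^ (-(p / 2 - 1)) = (L : ℝ) ^ (-(1 + p / 2)) * L ^ 2 := by
      rw [← Real.rpow_natCast, ← Real.rpow_add hLpos]
      congr 1
      push_cast
      ring
    have h3 : ((L : ℝ) + 1) ^ 2 ≤ 4 * L ^ 2 := by nlinarith
    calc R * (L : ℝ) ^ (-(1 + p / 2)) * (L + 1) ^ 2
        ≤ R * (L : ℝ) ^ (-(1 + p / 2)) * (4 * L ^ 2) := by gcongr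
      _ = _ := by rw [e]; ring
  · have e : (L : ℝ) ^ (-(p / 2)) = (L : ℝ) ^ (-(1 + p / 2)) * L := by
      nth_rw 3 [← Real.rpow_one (L : ℝ)]
      rw [← Real.rpow_add hLpos]
      congr 1
      ring
    have h3 : R * (L : ℝ) ^ (-(1 + p / 2)) * (L + 1) ≤ 2 * R * (L : ℝ) ^ (-(p / 2)) := by
      calc R * (L : ℝ) ^ (-(1 + p / 2)) * (L + 1)
          ≤ R * (L : ℝ) ^ (-(1 + p / 2)) * (2 * L) := by gcongr; linarith
        _ = _ := by rw [e]; ring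
    have h4 : (2 * R * (L : ℝ) ^ (-(p / 2))) ^ (1 / p) = A * (L : ℝ) ^ (-(1 / 2) : ℝ) := by
      rw [Real.mul_rpow (by positivity) (by positivity), ← Real.rpow_mul hLpos.le]
      congr 2
      field_simp
    have h5 : (L : ℝ) ^ (-(1 / 2) : ℝ) * √L = 1 := by
      rw [Real.sqrt_eq_rpow, ← Real.rpow_add hLpos]
      norm_num
    calc _ ≤ ENNReal.ofReal (2 * R * (L : ℝ) ^ (-(p / 2))) ^ (1 / p)
          * ENNReal.ofReal (K + 4 * (δ / (8 * A)) * √L) := by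
          gcongr
          exact hK L hL
      _ = ENNReal.ofReal (A * (L : ℝ) ^ (-(1 / 2) : ℝ) * (K + 4 * (δ / (8 * A)) * √L)) := by
          rw [ENNReal.ofReal_rpow_of_nonneg (by positivity) (by positivity), h4,
            ← ENNReal.ofReal_mul (by positivity)]
      _ ≤ _ := by
          refine ENNReal.ofReal_le_ofReal ?_
          have : A * (L : ℝ) ^ (-(1 / 2) : ℝ) * (K + 4 * (δ / (8 * A)) * √L)
              = A * K * (L : ℝ) ^ (-(1 / 2) : ℝ)
                + δ / 2 * ((L : ℝ) ^ (-(1 / 2) : ℝ) * √L) := by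
            field_simp
            ring
          rw [this, h5]
          linarith

/-- The law with atoms of mass at least `w i` at `L i`, and the remaining mass at `0`. -/
lemma exists_pmf_of_atoms (w : ℕ → ℝ≥0∞) (hw : ∑' i, w i ≤ 1) (L : ℕ → ℕ) :
    ∃ q : PMF ℕ, (∀ i, w i ≤ q (L i)) ∧
      ∀ H : ℕ → ℝ≥0∞, ∑' j, q j * H j ≤ H 0 + ∑' i, w i * H (L i) := by
  -- A law on indices, with the leftover mass at index 0; pushing it forward adds the masses of
  -- coinciding L i.
  let W' : ℕ → ℝ≥0∞ := fun | 0 => 1 - ∑' i, w i | i + 1 => w i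
  let L' : ℕ → ℕ := fun | 0 => 0 | i + 1 => L i
  have hW' : ∑' i, W' i = 1 := by
    rw [tsum_eq_zero_add' ENNReal.summable]
    exact tsub_add_cancel_of_le hw
  let W : PMF ℕ := ⟨W', hW' ▸ ENNReal.summable.hasSum⟩
  refine ⟨W.map L', fun i => ?_, fun H => ?_⟩
  · rw [PMF.map_apply]
    refine le_trans (le_of_eq ?_) (ENNReal.le_tsum (i + 1))
    rw [if_pos rfl]
    rfl
  · have h : ∑' j, (W.map L') j * H j = ∑' i, W i * H (L' i) := by
      rw [← lintegral_pmf, ← lintegral_pmf, ← PMF.toMeasure_map _ W Measurable.of_discrete,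
        lintegral_map Measurable.of_discrete Measurable.of_discrete]
    rw [h, tsum_eq_zero_add' ENNReal.summable]
    refine add_le_add ?_ le_rfl
    exact mul_le_of_le_one_left' (W.coe_le_one 0)

/-- Subadditivity of x ↦ x^(1/p) separates the atoms, and exchanging the sums over n and i produces
`truncSum`. The leftover mass at 0 drops out because min(0, n) = 0. -/
lemma summable_mul_toReal {a : ℕ → ℝ} (ha : Tendsto a atTop (𝓝 0)) {p : ℝ} (hp : 2 < p)
    {w : ℕ → ℝ≥0∞} {L : ℕ → ℕ} {q : PMF ℕ}
    (hq : ∀ H : ℕ → ℝ≥0∞, ∑' j, q j * H j ≤ H 0 + ∑' i, w i * H (L i))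
    (hw : ∑' i, (w i * (L i + 1)) ^ (1 / p) * truncSum (fun n => |a n|) (L i) ≠ ∞)
    {C : ℝ≥0∞} (hC : C ≠ ∞) {e : ℕ → ℝ≥0∞}
    (he : ∀ n, e n ≤ (∑' j, q j * ((j + 1) * (min j n : ℕ) ^ p)) ^ (1 / p) + C) :
    Summable fun n : ℕ => a n / (n : ℝ) ^ (3 / 2 : ℝ) * (e n).toReal := by
  have hp0 : 0 < p := by linarith
  set β : ℕ → ℝ≥0∞ := fun n => ENNReal.ofReal (|a n| / (n : ℝ) ^ (3 / 2 : ℝ))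
  have he' : ∀ n, e n ≤ ∑' i, (w i * (L i + 1)) ^ (1 / p) * (min (L i) n : ℕ) + C := by
    intro n
    refine (he n).trans (add_le_add_left ?_ _)
    calc _ ≤ (∑' i, w i * ((L i + 1) * (min (L i) n : ℕ) ^ p)) ^ (1 / p) := by
          refine ENNReal.rpow_le_rpow ?_ (by positivity)
          refine (hq fun j => (j + 1) * (min j n : ℕ) ^ p).trans_eq ?_
          simp [ENNReal.zero_rpow_of_pos hp0]
      _ ≤ ∑' i, (w i * ((L i + 1) * (min (L i) n : ℕ) ^ p)) ^ (1 / p) :=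
          ENNReal.rpow_tsum_le _ (by positivity) ((div_le_one hp0).2 (by linarith))
      _ = _ := by
          refine tsum_congr fun i => ?_
          rw [← mul_assoc, ENNReal.mul_rpow_of_nonneg _ _ (by positivity), ← ENNReal.rpow_mul,
            mul_one_div_cancel hp0.ne', ENNReal.rpow_one]
  -- This is `truncSum` at L = 1; at n = 0 the weight is 0 because division by zero gives 0.
  have hβ : ∑' n, β n ≠ ∞ := by
    obtain ⟨K, -, hK⟩ := truncSum_le (fun n => abs_nonneg (a n)) (by simpa using ha.abs) one_pos
    refine ne_top_of_le_ne_top ENNReal.ofReal_ne_top (le_trans ?_ (hK 1 le_rfl))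
    refine ENNReal.tsum_le_tsum fun n => ?_
    rcases Nat.eq_zero_or_pos n with rfl | hn
    · simp [β]
    · rw [min_eq_left (by omega)]
      simp [β]
  have hfin : ∑' n, β n * e n ≠ ∞ := by
    refine ne_top_of_le_ne_top (ENNReal.add_ne_top.2 ⟨hw, ENNReal.mul_ne_top hβ hC⟩) ?_
    calc ∑' n, β n * e n
        ≤ ∑' n, (∑' i, (w i * (L i + 1)) ^ (1 / p) * (β n * (min (L i) n : ℕ)) + β n * C) := by
          refine ENNReal.tsum_le_tsum fun n => ?_
          refine (mul_le_mul_right (he' n) (β n)).trans_eq ?_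
          rw [mul_add, ← ENNReal.tsum_mul_left]
          congr 1
          exact tsum_congr fun i => by ring
      _ = _ := by
          rw [ENNReal.tsum_add, ENNReal.tsum_comm, ENNReal.tsum_mul_right]
          simp only [ENNReal.tsum_mul_left]
          rfl
  refine Summable.of_norm ((ENNReal.summable_toReal hfin).congr fun n => ?_)
  rw [ENNReal.toReal_mul, ENNReal.toReal_ofReal (by positivity), norm_mul, norm_div,
    Real.norm_of_nonneg ENNReal.toReal_nonneg, Real.norm_eq_abs,
    Real.norm_of_nonneg (by positivity : 0 ≤ (n : ℝ) ^ (3 / 2 : ℝ))]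

end
-- Choice of the gap law and conclusion
theorem theorem2 (a : ℕ → ℝ) (ha : Tendsto a atTop (𝓝 0)) (p : ℝ) (hp : 2 < p) :
    ∃ (Ω : Type) (M mΩ : MeasurableSpace Ω) (μ : Measure Ω) (_ : IsProbabilityMeasure μ)
      (T : Ω ≃ᵐ Ω) (f : Ω → ℝ) (Y : Ω → ℕ) (q : PMF ℕ),
      MeasurePreserving T μ μ ∧
      -- `M` is a sub-σ-algebra with `T M ⊆ M`, and `f` is `M`-measurable and in `L^p`
      M ≤ mΩ ∧
      (∀ A : Set Ω, MeasurableSet[M] A → MeasurableSet[M] (T '' A)) ∧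
      Measurable[M] f ∧
      MemLp f (ENNReal.ofReal p) μ ∧
      -- `(f ∘ T^j)` is the centred indicator of `0` along a stationary renewal-type Markov chain
      IsMarkovChain μ (fun j ω => Y (T^[j] ω)) (renewalTransition q) ∧
      (∀ ω, f ω = (Y ⁻¹' {0}).indicator 1 ω - μ.real (Y ⁻¹' {0})) ∧
      -- the weighted Maxwell-Woodroofe series converges (absolutely)
      Summable (fun n : ℕ => a n / (n : ℝ) ^ (3 / 2 : ℝ) *
        (eLpNorm (μ[birkhoffSum T f n | M]) (ENNReal.ofReal p) μ).toReal) ∧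
      -- the laws of `n^{-1/2} W(n,f,·)`, `n ≥ 1`, are not tight in the Hölder space
      ¬ IsTightMeasureSet {ν : Measure (HolderSpace (holderExponent p)) | ∃ n : ℕ, 1 ≤ n ∧
        ν = μ.map fun ω =>
          (n : ℝ) ^ (-(1 / 2) : ℝ) • holderPartialSum (holderExponent_le_one hp) T f n ω} := by
  have hp0 : 0 < p := by linarith
  -- R = i + 1 forces L^(1 + p/2) q(L) to be unbounded, while the budgets δ sum to 1.
  choose L hL1 hL2 hL3 using fun i : ℕ =>
    exists_gap_length (fun n => abs_nonneg (a n)) (by simpa using ha.abs) hp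
      (R := (i : ℝ) + 1) (δ := 1 / 2 / 2 ^ i) (by positivity) (by positivity)
  have hδ : ∑' i : ℕ, ENNReal.ofReal (1 / 2 / 2 ^ i) = 1 := by
    rw [← ENNReal.ofReal_tsum_of_nonneg (fun i => by positivity) (summable_geometric_two' 1),
      tsum_geometric_two', ENNReal.ofReal_one]
  let x : ℕ → ℝ := fun i => ((i : ℝ) + 1) * (L i : ℝ) ^ (-(1 + p / 2))
  have hx : ∀ i, 0 ≤ x i := fun i => by positivity
  -- Used twice: the total mass of the atoms is at most 1, and `q` has a finite second moment.
  have hw2 : ∑' i, ENNReal.ofReal (x i) * ((L i : ℝ≥0∞) + 1) ^ 2 ≤ 1 := by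
    refine le_trans (ENNReal.tsum_le_tsum fun i => ?_) hδ.le
    refine le_trans (le_of_eq ?_) (ENNReal.ofReal_le_ofReal (hL2 i))
    rw [ENNReal.ofReal_mul (hx i), ENNReal.ofReal_pow (by positivity),
      ENNReal.ofReal_add (by positivity) zero_le_one, ENNReal.ofReal_natCast, ENNReal.ofReal_one]
  have hw1 : ∑' i, ENNReal.ofReal (x i) ≤ 1 := by
    refine le_trans (ENNReal.tsum_le_tsum fun i => ?_) hw2
    exact le_mul_of_one_le_right' (one_le_pow₀ (by simp))
  obtain ⟨q, hqL, hqH⟩ := exists_pmf_of_atoms (fun i => ENNReal.ofReal (x i)) hw1 L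
  have hq2 : ∑' j, q j * ((j : ℝ≥0∞) + 1) ^ 2 ≠ ∞ := by
    refine ne_top_of_le_ne_top ?_ ((hqH _).trans (add_le_add_right hw2 _))
    simp
  have hq : meanGap q ≠ ∞ := ne_top_of_le_ne_top hq2 (meanGap_le q)
  have hD : meanResidual q ≠ ∞ := ne_top_of_le_ne_top hq2 (meanResidual_le q)
  refine ⟨RenewalSpace, pastAlgebra, inferInstance, renewalMeasure q,
    isProbabilityMeasure_renewalMeasure q hq, renewalShift, renewalObs q, residualTime, q,
    measurePreserving_renewalShift q, measurable_fst.comap_le,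
    fun A hA => measurableSet_pastAlgebra_image hA, measurable_pastAlgebra_renewalObs q,
    memLp_renewalObs q hq _, isMarkovChain_residualTime q, fun ω => rfl, ?_,
    not_isTightMeasureSet_holderPartialSum q hq hD hp fun K => ?_⟩
  · refine summable_mul_toReal ha hp hqH ?_ (ENNReal.mul_ne_top hD hq) fun n =>
      eLpNorm_condExp_birkhoffSum_le q hq hD n (by linarith)
    refine ne_top_of_le_ne_top ENNReal.one_ne_top ?_
    refine le_trans (ENNReal.tsum_le_tsum fun i => ?_) hδ.le
    refine le_trans (le_of_eq ?_) (hL3 i)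
    rw [ENNReal.ofReal_mul (hx i), ENNReal.ofReal_add (by positivity) zero_le_one,
      ENNReal.ofReal_natCast, ENNReal.ofReal_one]
  · obtain ⟨i, hi⟩ := exists_nat_ge K
    refine ⟨L i, hL1 i, hi.trans ?_⟩
    have hLpos : (0 : ℝ) < L i := by exact_mod_cast hL1 i
    have h1 : x i ≤ (q (L i)).toReal := by
      rw [← ENNReal.toReal_ofReal (hx i)]
      exact ENNReal.toReal_mono (PMF.apply_ne_top q _) (hqL i)
    calc (i : ℝ) ≤ (L i : ℝ) ^ (1 + p / 2) * x i := by
          have : (L i : ℝ) ^ (1 + p / 2) * x i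
              = (i + 1) * ((L i : ℝ) ^ (1 + p / 2) * (L i : ℝ) ^ (-(1 + p / 2))) := by
            simp only [x]; ring
          rw [this, ← Real.rpow_add hLpos, add_neg_cancel, Real.rpow_zero]
          linarith
      _ ≤ _ := by gcongr
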